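/- Let $I\subset\mathbb R$ be an open interval and $T^3=\mathbb R^3/\mathbb Z^3$, with coordinates $(\tau,\theta,x,y)$ on $I\times T^3$. Let $g$ be a $C^\infty$ Lorentz metric of signature $(-,+,+,+)$ on $I\times T^3$ whose slices $\{\tau\}\times T^3$ are spacelike, time-oriented so that $\tau$ increases to the future. Let $f\ge 0$ be a $C^\infty$ function on the bundle of future-directed covectors $p$ with $g^{\mu\nu}p_\mu p_\nu=-1$, written as a function of $(\tau,\theta,x,y,p_1,p_2,p_3)$. Assume that $g$ and $f$ are invariant under the group $T^2$ acting by translations of $(x,y)$, and that $(g,f)$ solves the Einstein–Vlasov system with particles of mass one: $f$ is constant along the geodesic flow, $$g^{\mu\nu}p_\nu\,\partial_\mu f-\tfrac12\,(\partial_i g^{\alpha\beta})\,p_\alpha p_\beta\,\partial_{p_i}f=0,$$ and the Einstein tensor satisfies $$G_{\mu\nu}=T_{\mu\nu},\qquad T_{\mu\nu}=\int_{\mathbb R^3} \frac{f\,p_\mu p_\nu}{\sqrt{-\det g}\;p^0}\,dp_1\,dp_2\,dp_3 .$$ Assume that on some slice $\{\tau_0\}\times T^3$ the support of $f$ is bounded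 in $p$ and the number of particles $\int_{T^3}\int_{\mathbb R^3} f\,dp\,d\theta\,dx\,dy$ is not zero. Let $t$ be the function on $I\times T^3$ whose value at a point is the area of the $T^2$ orbit through that point. Then: 1. the spacetime gradient $\nabla t$ vanishes nowhere; 2. at every point, $dt(k)\neq 0$ for every nonzero null vector $k$ orthogonal to the $T^2$ orbit. In particular, wherever $g$ is written in conformal coordinates, $g=e^{2(\tilde\nu-U)}(-d\tilde t^2+d\tilde\theta^2)+e^{2U}[d\tilde x+A\,d\tilde y+(\tilde G+A\tilde H)\,d\tilde\theta]^2+e^{-2U}t^2[d\tilde y+\tilde H\,d\tilde\theta]^2$, with metric functions of $(\tilde t,\tilde\theta)$ only, the null derivatives $t_\pm=t_{\tilde t}\pm t_{\tilde\theta}$ are never zero; 3. consequently the orbit area $t$ is not constant, so the exceptional flat case with orbits of constant area does not occur. -/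

import Mathlib

open scoped ContDiff

noncomputable section

namespace EinsteinVlasov

/-- Points of the universal cover of `I × T³`, with coordinates
`(t, θ, x, y) = (x 0, x 1, x 2, x 3)`; the torus is `T³ = ℝ³ / ℤ³`. -/
abbrev Point : Type := Fin 4 → ℝ

/-- Spatial covariant momenta `(p_θ, p_x, p_y)`. -/
abbrev Mom : Type := Fin 3 → ℝ

/-- A field of bilinear forms, given by its coordinate components `g_{μν}`. -/
abbrev MetricField : Type := Point → Matrix (Fin 4) (Fin 4) ℝ

/-- The region `I × ℝ³`. -/
def slab (I : Set ℝ) : Set Point := {x | x 0 ∈ I}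

/-- The coordinate vector `∂_μ`. -/
def unitVec (μ : Fin 4) : Point := Pi.single μ 1

/-- The partial derivative `∂_μ F` at `x`. -/
def pd (μ : Fin 4) (F : Point → ℝ) (x : Point) : ℝ := fderiv ℝ F x (unitVec μ)

/-! ### Curvature -/

/-- The scalar product `g(v, w)` at `x`. -/
def inner4 (g : MetricField) (x : Point) (v w : Fin 4 → ℝ) : ℝ :=
  ∑ μ, ∑ ν, g x μ ν * v μ * w ν

/-- Components `g^{μν}` of the inverse metric. -/
def gInv (g : MetricField) (x : Point) (μ ν : Fin 4) : ℝ := (g x)⁻¹ μ ν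

/-- Christoffel symbols `Γ^l_{μν}` of the Levi-Civita connection. -/
def christoffel (g : MetricField) (l μ ν : Fin 4) (x : Point) : ℝ :=
  (1 / 2) * ∑ σ, gInv g x l σ *
    (pd μ (fun y => g y σ ν) x + pd ν (fun y => g y σ μ) x - pd σ (fun y => g y μ ν) x)

/-- The Ricci tensor
`R_{μν} = ∂_l Γ^l_{μν} - ∂_ν Γ^l_{lμ} + Γ^l_{lσ} Γ^σ_{μν} - Γ^l_{νσ} Γ^σ_{lμ}`. -/
def ricci (g : MetricField) (μ ν : Fin 4) (x : Point) : ℝ :=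
  (∑ l, pd l (christoffel g l μ ν) x) - (∑ l, pd ν (christoffel g l l μ) x)
    + (∑ l, ∑ σ, christoffel g l l σ x * christoffel g σ μ ν x)
    - ∑ l, ∑ σ, christoffel g l ν σ x * christoffel g σ l μ x

/-- The scalar curvature. -/
def scalarCurv (g : MetricField) (x : Point) : ℝ := ∑ μ, ∑ ν, gInv g x μ ν * ricci g μ ν x

/-- The Einstein tensor `G_{μν} = R_{μν} - (1/2) R g_{μν}`. -/
def einstein (g : MetricField) (μ ν : Fin 4) (x : Point) : ℝ :=
  ricci g μ ν x - (1 / 2) * scalarCurv g x * g x μ ν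

/-- The gradient vector `g^{μν} ∂_ν F`. -/
def gradient (g : MetricField) (F : Point → ℝ) (x : Point) : Fin 4 → ℝ :=
  fun μ => ∑ ν, gInv g x μ ν * pd ν F x

/-! ### Vlasov matter, particles of mass one -/

/-- The component `p_0` of the future directed covector of the mass shell with spatial
components `p`: the solution of `g^{μν} p_μ p_ν = -1` with
`p^0 = g^{00} p_0 + g^{0i} p_i > 0`. -/
def energy (g : MetricField) (x : Point) (p : Mom) : ℝ :=
  let a := gInv g x 0 0
  let b := ∑ i : Fin 3, gInv g x 0 i.succ * p i
  let c := ∑ i : Fin 3, ∑ j : Fin 3, gInv g x i.succ j.succ * p i * p j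
  (-b + Real.sqrt (b ^ 2 - a * (c + 1))) / a

/-- The covariant four-momentum `p_μ` on the mass shell with spatial components `p`. -/
def momLower (g : MetricField) (x : Point) (p : Mom) : Fin 4 → ℝ :=
  Matrix.vecCons (energy g x p) p

/-- The contravariant four-momentum `p^μ`. -/
def momUpper (g : MetricField) (x : Point) (p : Mom) (μ : Fin 4) : ℝ :=
  ∑ ν, gInv g x μ ν * momLower g x p ν

/-- The derivative of `f` at `(x, p)` along the geodesic flow of the mass shell,
`dx^μ/ds = p^μ`, `dp_i/ds = -(1/2) ∂_i g^{αβ} p_α p_β`. -/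
def liouville (g : MetricField) (f : Point → Mom → ℝ) (x : Point) (p : Mom) : ℝ :=
  (∑ μ, momUpper g x p μ * pd μ (fun y => f y p) x)
    - (1 / 2) * ∑ i : Fin 3,
        (∑ α, ∑ β, pd i.succ (fun y => gInv g y α β) x * momLower g x p α * momLower g x p β)
          * fderiv ℝ (f x) p (Pi.single i 1)

/-- The stress-energy tensor `T_{μν} = ∫ f p_μ p_ν / (√(-det g) p^0) dp_1 dp_2 dp_3`. -/
def stressEnergy (g : MetricField) (f : Point → Mom → ℝ) (μ ν : Fin 4) (x : Point) : ℝ :=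
  ∫ p : Mom, f x p * momLower g x p μ * momLower g x p ν
    / (Real.sqrt (-(g x).det) * momUpper g x p 0)

/-- The number of particles on the slice `{t} × T³`, which is `∫_{T³} ∫_{ℝ³} f dp dz`. -/
def particleNumber (f : Point → Mom → ℝ) (t : ℝ) : ℝ :=
  ∫ z in Set.Icc (0 : Fin 3 → ℝ) 1, ∫ p : Mom, f (Matrix.vecCons t z) p

/-! ### Spacetimes with `T²` symmetry -/

/-- A smooth Lorentz metric of signature `(-,+,+,+)` on `I × T³`, `I` an open interval,
all of whose slices `{t} × T³` are spacelike. -/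
structure IsSpacetimeOnTorus (I : Set ℝ) (g : MetricField) : Prop where
  isOpen : IsOpen I
  ordConnected : I.OrdConnected
  smooth : ∀ μ ν, ContDiffOn ℝ ∞ (fun x => g x μ ν) (slab I)
  lorentzian : ∀ x ∈ slab I, ∃ P : Matrix (Fin 4) (Fin 4) ℝ, IsUnit P.det ∧
    P.transpose * g x * P = Matrix.diagonal ![-1, 1, 1, 1]
  spacelike : ∀ x ∈ slab I, ∀ v : Fin 4 → ℝ, v 0 = 0 → v ≠ 0 → 0 < inner4 g x v v
  periodic : ∀ x ∈ slab I, ∀ i : Fin 3, g (x + unitVec i.succ) = g x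

/-- A smooth nonnegative distribution function on the mass shell over `I × T³`. -/
structure IsDistribution (I : Set ℝ) (f : Point → Mom → ℝ) : Prop where
  smooth : ContDiffOn ℝ ∞ (fun z : Point × Mom => f z.1 z.2) (slab I ×ˢ Set.univ)
  nonneg : ∀ x ∈ slab I, ∀ p, 0 ≤ f x p
  periodic : ∀ x ∈ slab I, ∀ (i : Fin 3) (p : Mom), f (x + unitVec i.succ) p = f x p

/-- Invariance under the group `T²` acting by translations of `(x, y)`. (The lift of a
translation to the cotangent bundle does not change the components `p_μ`.) -/
def IsT2Invariant {β : Type*} (I : Set ℝ) (F : Point → β) : Prop :=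
  ∀ x ∈ slab I, ∀ a b : ℝ, F (x + a • unitVec 2 + b • unitVec 3) = F x

/-- `(g, f)` is a `T²`-symmetric solution on `I × T³` of the Einstein-Vlasov equations
`G_{μν} = T_{μν}`. -/
structure IsT2SymmetricEinsteinVlasov (I : Set ℝ) (g : MetricField) (f : Point → Mom → ℝ) :
    Prop where
  spacetime : IsSpacetimeOnTorus I g
  distribution : IsDistribution I f
  metric_invariant : IsT2Invariant I g
  matter_invariant : IsT2Invariant I f
  vlasov_eq : ∀ x ∈ slab I, ∀ p, liouville g f x p = 0
  einstein_eq : ∀ x ∈ slab I, ∀ μ ν, einstein g μ ν x = stressEnergy g f μ ν x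

/-- On the slice of time `t` the momenta in the support of `f` are bounded. -/
def HasBoundedSupportAt (f : Point → Mom → ℝ) (t : ℝ) : Prop :=
  ∃ C : ℝ, ∀ x : Point, x 0 = t → ∀ p : Mom, C < ‖p‖ → f x p = 0

/-- The area of the `T²` orbit through `x`: the induced metric on the orbit
`{(t, θ)} × (ℝ/ℤ)²` has constant coefficients, so this is the root of its determinant. -/
def orbitArea (g : MetricField) (x : Point) : ℝ :=
  Real.sqrt (g x 2 2 * g x 3 3 - g x 2 3 * g x 3 2)

/-- `k` is a nonzero null vector at `x`, orthogonal to the `T²` orbit through `x`. -/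
def IsOrbitNormalNull (g : MetricField) (x : Point) (k : Fin 4 → ℝ) : Prop :=
  k ≠ 0 ∧ inner4 g x k k = 0 ∧ inner4 g x k (unitVec 2) = 0 ∧ inner4 g x k (unitVec 3) = 0

end EinsteinVlasov

end

noncomputable section

namespace EinsteinVlasov

section

open Filter Topology

/-! ### Calculus with partial derivatives -/

section PartialDerivatives

variable {F G : Point → ℝ} {x : Point}

/-! The proof combines the constraint equations on one slice with the propagation of vacuum by the
Vlasov equation. At each point take an orthonormal frame `E₀, E₁, E₂, E₃`: `E₂, E₃` span the orbit,
`E₁` is tangent to the slice and normal to the orbit, and `E₀` is the unit normal of the slice. Its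
coordinate matrix `L` is lower triangular. With `W = t²` the squared orbit area and `s = ±1`, the
quantity `nullDeriv g s` is `L 0 0` times `dW(E₀ + s E₁)`. The combination `G(E₀, E₀ + s E₁)` of the
Hamiltonian and momentum constraints contains no second time derivatives. It yields, along the
circle of `θ`, `s ∂_θ N ≤ b N - κ G(E₀, E₀ + s E₁)`, where `N = nullDeriv g s` and `κ > 0`; the
discarded terms are squares (`ricciJet_identity`, `nullDeriv_evolution`). For Vlasov matter of mass
one, `T(E₀, E₀ + s E₁) ≥ 0`, strictly wherever `f` does not vanish identically in `p`
(`nullStress_nonneg`, `nullStress_pos`). If `N` vanishes somewhere, periodicity in `θ` forces the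
source to vanish on the whole circle (`source_nonpos_of_periodic_of_zero`), so `f = 0` on that
slice. Vanishing of `f` propagates to every other slice (`exists_propagation_rate`), contradicting
the nonzero particle number. Hence `N` has no zeros (`nullDeriv_ne_zero`). The same propagation
estimate keeps the momentum support bounded on every slice, so the integrals in `T` converge. Every
null vector normal to the orbit is a multiple of `E₀ + E₁` or `E₀ - E₁`, which gives the claim on
null derivatives. A zero of the gradient of `t`, in particular constant `t`, would make `N` vanish.
-/

lemma pd_add (μ : Fin 4) (hF : DifferentiableAt ℝ F x) (hG : DifferentiableAt ℝ G x) :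
    pd μ (fun y => F y + G y) x = pd μ F x + pd μ G x := by
  simp [pd, fderiv_fun_add hF hG]

lemma pd_sub (μ : Fin 4) (hF : DifferentiableAt ℝ F x) (hG : DifferentiableAt ℝ G x) :
    pd μ (fun y => F y - G y) x = pd μ F x - pd μ G x := by
  simp [pd, fderiv_fun_sub hF hG]

lemma pd_neg (μ : Fin 4) : pd μ (fun y => - F y) x = - pd μ F x := by
  simp [pd]

lemma pd_mul (μ : Fin 4) (hF : DifferentiableAt ℝ F x) (hG : DifferentiableAt ℝ G x) :
    pd μ (fun y => F y * G y) x = pd μ F x * G x + F x * pd μ G x := by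
  simp [pd, fderiv_fun_mul hF hG]; ring

lemma pd_const_mul (μ : Fin 4) (c : ℝ) (hF : DifferentiableAt ℝ F x) :
    pd μ (fun y => c * F y) x = c * pd μ F x := by
  simp [pd, fderiv_const_mul hF]

lemma pd_const (μ : Fin 4) (c : ℝ) : pd μ (fun _ => c) x = 0 := by
  simp [pd]

lemma pd_sum {ι : Type*} (s : Finset ι) {H : ι → Point → ℝ} (μ : Fin 4)
    (h : ∀ i ∈ s, DifferentiableAt ℝ (H i) x) :
    pd μ (fun y => ∑ i ∈ s, H i y) x = ∑ i ∈ s, pd μ (H i) x := by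
  simp [pd, fderiv_fun_sum h]

lemma pd_congr (μ : Fin 4) (h : F =ᶠ[𝓝 x] G) : pd μ F x = pd μ G x := by
  simp [pd, h.fderiv_eq]

lemma contDiffAt_pd (μ : Fin 4) (hF : ContDiffAt ℝ ∞ F x) : ContDiffAt ℝ ∞ (pd μ F) x :=
  (hF.fderiv_right (m := ∞) (by norm_num)).clm_apply contDiffAt_const

lemma pd_comm (μ ν : Fin 4) (hF : ContDiffAt ℝ ∞ F x) : pd μ (pd ν F) x = pd ν (pd μ F) x := by
  have hd : DifferentiableAt ℝ (fderiv ℝ F) x :=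
    (hF.fderiv_right (m := ∞) (by norm_num)).differentiableAt (by norm_num)
  have hs := hF.isSymmSndFDerivAt (by
    rw [minSmoothness_of_isRCLikeNormedField]; exact WithTop.coe_le_coe.2 (le_top : (2 : ℕ∞) ≤ ⊤))
  have key : ∀ a b : Fin 4, pd a (pd b F) x = fderiv ℝ (fderiv ℝ F) x (unitVec a) (unitVec b) := by
    intro a b
    change fderiv ℝ (fun y => fderiv ℝ F y (unitVec b)) x (unitVec a) = _
    rw [fderiv_clm_apply hd (by fun_prop)]
    simp
  rw [key, key, hs.eq]

lemma fderiv_apply_eq_sum_pd (v : Point) : fderiv ℝ F x v = ∑ μ, v μ * pd μ F x := by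
  conv_lhs => rw [show v = ∑ μ, v μ • unitVec μ by
    ext i; simp [unitVec, Finset.sum_apply, Pi.single_apply]]
  simp [pd]

end PartialDerivatives

/-! ### Regular metric fields depending on the first two coordinates -/

/-- A smooth field of nondegenerate symmetric forms on an open set, whose components do not
depend on the last two coordinates. -/
structure IsRegularOn (g : MetricField) (U : Set Point) : Prop where
  isOpen : IsOpen U
  smooth : ∀ x ∈ U, ∀ μ ν, ContDiffAt ℝ ∞ (fun y => g y μ ν) x
  det_ne_zero : ∀ x ∈ U, (g x).det ≠ 0
  symm : ∀ x ∈ U, ∀ μ ν, g x μ ν = g x ν μ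
  pd_two : ∀ x ∈ U, ∀ μ ν, pd 2 (fun y => g y μ ν) x = 0
  pd_three : ∀ x ∈ U, ∀ μ ν, pd 3 (fun y => g y μ ν) x = 0

lemma contDiffAt_det {n : Type*} [Fintype n] [DecidableEq n] {A : Point → Matrix n n ℝ} {x : Point}
    (h : ∀ i j, ContDiffAt ℝ ∞ (fun y => A y i j) x) :
    ContDiffAt ℝ ∞ (fun y => (A y).det) x := by
  simp only [Matrix.det_apply]
  exact ContDiffAt.sum fun σ _ => (contDiffAt_prod fun i _ => h _ _).const_smul _

namespace IsRegularOn

variable {g : MetricField} {U : Set Point} {x : Point}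

lemma contDiffAt_gInv (hg : IsRegularOn g U) (hx : x ∈ U) (μ ν : Fin 4) :
    ContDiffAt ℝ ∞ (fun y => gInv g y μ ν) x := by
  have h1 : (fun y => gInv g y μ ν) = fun y => (g y).det⁻¹ * (g y).adjugate μ ν := by
    ext y; simp [gInv, Matrix.inv_def]
  rw [h1]
  refine ((contDiffAt_det (hg.smooth x hx)).inv (hg.det_ne_zero x hx)).mul ?_
  simp only [Matrix.adjugate_apply]
  refine contDiffAt_det fun i j => ?_
  by_cases h : i = ν
  · subst h; simpa using contDiffAt_const
  · simpa [Matrix.updateRow_ne h] using hg.smooth x hx i j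

lemma contDiffAt_pd_metric (hg : IsRegularOn g U) (hx : x ∈ U) (l μ ν : Fin 4) :
    ContDiffAt ℝ ∞ (fun y => pd l (fun z => g z μ ν) y) x :=
  contDiffAt_pd l (hg.smooth x hx μ ν)

lemma contDiffAt_christoffel (hg : IsRegularOn g U) (hx : x ∈ U) (l μ ν : Fin 4) :
    ContDiffAt ℝ ∞ (christoffel g l μ ν) x := by
  unfold christoffel
  refine contDiffAt_const.mul (ContDiffAt.sum fun σ _ => (hg.contDiffAt_gInv hx _ _).mul ?_)
  exact ((hg.contDiffAt_pd_metric hx _ _ _).add (hg.contDiffAt_pd_metric hx _ _ _)).sub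
    (hg.contDiffAt_pd_metric hx _ _ _)

lemma eventually_mem (hg : IsRegularOn g U) (hx : x ∈ U) : ∀ᶠ y in 𝓝 x, y ∈ U := hg.isOpen.mem_nhds hx

lemma pd_symm (hg : IsRegularOn g U) (hx : x ∈ U) (l μ ν : Fin 4) :
    pd l (fun y => g y μ ν) x = pd l (fun y => g y ν μ) x :=
  pd_congr l ((hg.eventually_mem hx).mono fun y hy => hg.symm y hy μ ν)

lemma christoffel_symm (hg : IsRegularOn g U) (hx : x ∈ U) (l μ ν : Fin 4) :
    christoffel g l μ ν x = christoffel g l ν μ x := by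
  unfold christoffel
  refine congrArg _ (Finset.sum_congr rfl fun σ _ => ?_)
  rw [hg.pd_symm hx σ μ ν]; ring

lemma gInv_mul (hg : IsRegularOn g U) (hx : x ∈ U) (μ ν : Fin 4) :
    ∑ σ, gInv g x μ σ * g x σ ν = if μ = ν then 1 else 0 := by
  have := congrFun (congrFun (Matrix.nonsing_inv_mul (g x) (hg.det_ne_zero x hx).isUnit) μ) ν
  simpa [Matrix.mul_apply, Matrix.one_apply, gInv] using this

lemma gInv_symm (hg : IsRegularOn g U) (hx : x ∈ U) (μ ν : Fin 4) : gInv g x μ ν = gInv g x ν μ := by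
  have h : (g x).transpose = g x := by ext i j; exact hg.symm x hx j i
  have h2 := Matrix.transpose_nonsing_inv (g x)
  rw [h] at h2
  exact congrFun (congrFun h2 ν) μ

end IsRegularOn

end

/-! ### Derivatives of the metric and of the area at a point where the metric is Minkowskian. -/

section

open Filter Topology

/-- The squared area of the orbits. -/
def areaSq (g : MetricField) (x : Point) : ℝ := g x 2 2 * g x 3 3 - g x 2 3 * g x 3 2

/-- The derivative of the squared orbit area along a null vector field orthogonal to the orbits. -/
def nullDeriv (g : MetricField) (s : ℝ) (x : Point) : ℝ :=
  -(gInv g x 0 0 * pd 0 (areaSq g) x + gInv g x 0 1 * pd 1 (areaSq g) x)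
    + s * Real.sqrt (gInv g x 0 1 ^ 2 - gInv g x 0 0 * gInv g x 1 1) * pd 1 (areaSq g) x

/-- The diagonal entries of the Minkowski metric. -/
def sgn : Fin 4 → ℝ := ![-1, 1, 1, 1]

namespace IsRegularOn

variable {g : MetricField} {U : Set Point} {x : Point}

lemma differentiableAt (hg : IsRegularOn g U) (hx : x ∈ U) (μ ν : Fin 4) :
    DifferentiableAt ℝ (fun y => g y μ ν) x :=
  (hg.smooth x hx μ ν).differentiableAt (by norm_num)

lemma differentiableAt_gInv (hg : IsRegularOn g U) (hx : x ∈ U) (μ ν : Fin 4) :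
    DifferentiableAt ℝ (fun y => gInv g y μ ν) x :=
  (hg.contDiffAt_gInv hx μ ν).differentiableAt (by norm_num)

lemma differentiableAt_pd (hg : IsRegularOn g U) (hx : x ∈ U) (l μ ν : Fin 4) :
    DifferentiableAt ℝ (fun y => pd l (fun z => g z μ ν) y) x :=
  (hg.contDiffAt_pd_metric hx l μ ν).differentiableAt (by norm_num)

lemma pd_pd_two (hg : IsRegularOn g U) (hx : x ∈ U) (l μ ν : Fin 4) :
    pd l (pd 2 (fun z => g z μ ν)) x = 0 := by
  rw [pd_congr (G := fun _ => 0) l ((hg.eventually_mem hx).mono fun y hy => hg.pd_two y hy μ ν)]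
  exact pd_const _ _

lemma pd_pd_three (hg : IsRegularOn g U) (hx : x ∈ U) (l μ ν : Fin 4) :
    pd l (pd 3 (fun z => g z μ ν)) x = 0 := by
  rw [pd_congr (G := fun _ => 0) l ((hg.eventually_mem hx).mono fun y hy => hg.pd_three y hy μ ν)]
  exact pd_const _ _

lemma gInv_of_eq_diagonal (hη : g x = Matrix.diagonal sgn) (μ ν : Fin 4) :
    gInv g x μ ν = if μ = ν then sgn μ else 0 := by
  have h : (g x)⁻¹ = Matrix.diagonal sgn := by
    apply Matrix.inv_eq_left_inv
    rw [hη, Matrix.diagonal_mul_diagonal, ← Matrix.diagonal_one]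
    congr 1; ext i; fin_cases i <;> simp [sgn]
  rw [gInv, h, Matrix.diagonal_apply]

/-- Differentiate `g⁻¹ g = 1`; at the point itself both factors are diagonal, so each sum over the
contracted index has one term. -/
lemma pd_gInv_of_eq_diagonal (hg : IsRegularOn g U) (hx : x ∈ U)
    (hη : g x = Matrix.diagonal sgn) (l μ ν : Fin 4) :
    pd l (fun y => gInv g y μ ν) x = - (sgn μ * sgn ν * pd l (fun y => g y μ ν) x) := by
  have h1 : pd l (fun y => ∑ σ, gInv g y μ σ * g y σ ν) x = 0 := by
    rw [pd_congr (G := fun _ => if μ = ν then 1 else 0) l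
      ((hg.eventually_mem hx).mono fun y hy => hg.gInv_mul hy μ ν)]
    exact pd_const _ _
  rw [pd_sum _ _ fun σ _ => (hg.differentiableAt_gInv hx μ σ).fun_mul (hg.differentiableAt hx σ ν)] at h1
  simp_rw [pd_mul l (hg.differentiableAt_gInv hx μ _) (hg.differentiableAt hx _ ν),
    gInv_of_eq_diagonal hη, hη, Matrix.diagonal_apply] at h1
  simp only [mul_ite, mul_zero, ite_mul, zero_mul, Finset.sum_add_distrib, Finset.sum_ite_eq,
    Finset.sum_ite_eq', Finset.mem_univ, if_true] at h1
  have h2 : sgn ν * sgn ν = 1 := by fin_cases ν <;> simp [sgn]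
  linear_combination sgn ν * h1 - pd l (fun y => gInv g y μ ν) x * h2

lemma pd_christoffel_of_eq_diagonal (hg : IsRegularOn g U) (hx : x ∈ U)
    (hη : g x = Matrix.diagonal sgn) (k l μ ν : Fin 4) :
    pd k (christoffel g l μ ν) x = (1 / 2) * (sgn l *
      (pd k (pd μ (fun y => g y l ν)) x + pd k (pd ν (fun y => g y l μ)) x
        - pd k (pd l (fun y => g y μ ν)) x)
      - ∑ σ, sgn l * sgn σ * pd k (fun y => g y l σ) x *
        (pd μ (fun y => g y σ ν) x + pd ν (fun y => g y σ μ) x - pd σ (fun y => g y μ ν) x)) := by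
  have hd : ∀ a b c, DifferentiableAt ℝ (fun y => pd a (fun z => g z b c) y) x :=
    hg.differentiableAt_pd hx
  have hd3 : ∀ σ, DifferentiableAt ℝ (fun y => pd μ (fun z => g z σ ν) y
      + pd ν (fun z => g z σ μ) y - pd σ (fun z => g z μ ν) y) x := fun σ =>
    ((hd _ _ _).fun_add (hd _ _ _)).fun_sub (hd _ _ _)
  unfold christoffel
  rw [pd_const_mul, pd_sum]
  · simp_rw [pd_mul k (hg.differentiableAt_gInv hx l _) (hd3 _),
      pd_sub k ((hd _ _ _).fun_add (hd _ _ _)) (hd _ _ _), pd_add k (hd _ _ _) (hd _ _ _),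
      hg.pd_gInv_of_eq_diagonal hx hη, gInv_of_eq_diagonal hη, Finset.sum_add_distrib, ite_mul,
      zero_mul, Finset.sum_ite_eq, Finset.mem_univ, if_true, neg_mul, Finset.sum_neg_distrib]
    ring
  · exact fun σ _ => (hg.differentiableAt_gInv hx l σ).fun_mul (hd3 σ)
  · exact DifferentiableAt.fun_sum fun σ _ => (hg.differentiableAt_gInv hx l σ).fun_mul (hd3 σ)

lemma christoffel_of_eq_diagonal (hη : g x = Matrix.diagonal sgn) (l μ ν : Fin 4) :
    christoffel g l μ ν x = (1 / 2) * (sgn l * (pd μ (fun y => g y l ν) x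
      + pd ν (fun y => g y l μ) x - pd l (fun y => g y μ ν) x)) := by
  simp only [christoffel, gInv_of_eq_diagonal hη, ite_mul, zero_mul, Finset.sum_ite_eq,
    Finset.mem_univ, if_true]

lemma contDiffAt_areaSq (hg : IsRegularOn g U) (hx : x ∈ U) : ContDiffAt ℝ ∞ (areaSq g) x :=
  ((hg.smooth x hx _ _).mul (hg.smooth x hx _ _)).sub
    ((hg.smooth x hx _ _).mul (hg.smooth x hx _ _))

lemma pd_areaSq (hg : IsRegularOn g U) (hx : x ∈ U) (k : Fin 4) :
    pd k (areaSq g) x = pd k (fun y => g y 2 2) x * g x 3 3 + g x 2 2 * pd k (fun y => g y 3 3) x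
      - (pd k (fun y => g y 2 3) x * g x 3 2 + g x 2 3 * pd k (fun y => g y 3 2) x) := by
  have hd := hg.differentiableAt hx
  unfold areaSq
  rw [pd_sub k ((hd _ _).fun_mul (hd _ _)) ((hd _ _).fun_mul (hd _ _)), pd_mul k (hd _ _) (hd _ _),
    pd_mul k (hd _ _) (hd _ _)]

lemma pd_pd_areaSq (hg : IsRegularOn g U) (hx : x ∈ U) (hη : g x = Matrix.diagonal sgn)
    (j k : Fin 4) :
    pd j (pd k (areaSq g)) x = pd j (pd k (fun y => g y 2 2)) x + pd j (pd k (fun y => g y 3 3)) x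
      + pd k (fun y => g y 2 2) x * pd j (fun y => g y 3 3) x
      + pd j (fun y => g y 2 2) x * pd k (fun y => g y 3 3) x
      - 2 * pd j (fun y => g y 2 3) x * pd k (fun y => g y 2 3) x := by
  have hd := hg.differentiableAt hx
  have hd2 : ∀ a b c, DifferentiableAt ℝ (fun y => pd a (fun z => g z b c) y) x :=
    hg.differentiableAt_pd hx
  rw [pd_congr j ((hg.eventually_mem hx).mono fun y hy => hg.pd_areaSq hy k)]
  rw [pd_sub, pd_add, pd_add, pd_mul j (hd2 _ _ _) (hd _ _), pd_mul j (hd2 _ _ _) (hd _ _),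
    pd_mul j (hd _ _) (hd2 _ _ _), pd_mul j (hd _ _) (hd2 _ _ _), hg.pd_symm hx j 3 2,
    hg.pd_symm hx k 3 2, hη]
  · simp [sgn]; ring
  all_goals first
    | exact (hd2 _ _ _).fun_mul (hd _ _)
    | exact (hd _ _).fun_mul (hd2 _ _ _)
    | exact ((hd2 _ _ _).fun_mul (hd _ _)).fun_add ((hd _ _).fun_mul (hd2 _ _ _))

lemma pd_one_nullDeriv_of_eq_diagonal (hg : IsRegularOn g U) (hx : x ∈ U)
    (hη : g x = Matrix.diagonal sgn) (s : ℝ) :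
    pd 1 (nullDeriv g s) x = pd 1 (fun y => g y 0 0) x * pd 0 (areaSq g) x
      - pd 1 (fun y => g y 0 1) x * pd 1 (areaSq g) x
      + s / 2 * (pd 1 (fun y => g y 0 0) x - pd 1 (fun y => g y 1 1) x) * pd 1 (areaSq g) x
      + pd 1 (pd 0 (areaSq g)) x + s * pd 1 (pd 1 (areaSq g)) x := by
  have hi := hg.differentiableAt_gInv hx
  have hA : ∀ k, DifferentiableAt ℝ (fun y => pd k (areaSq g) y) x := fun k =>
    (contDiffAt_pd k (hg.contDiffAt_areaSq hx)).differentiableAt (by norm_num)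
  -- The radicand in `nullDeriv`. It equals `1` at `x`, so the root is differentiable there and its
  -- derivative is half that of `D`.
  set D : Point → ℝ := fun y => gInv g y 0 1 * gInv g y 0 1 - gInv g y 0 0 * gInv g y 1 1 with hD
  have hDd : DifferentiableAt ℝ D x := ((hi _ _).fun_mul (hi _ _)).fun_sub ((hi _ _).fun_mul (hi _ _))
  have hDx : D x = 1 := by
    simp [hD, gInv_of_eq_diagonal hη, sgn]
  have hpD : pd 1 D x = pd 1 (fun y => g y 0 0) x - pd 1 (fun y => g y 1 1) x := by
    rw [hD, pd_sub _ ((hi _ _).fun_mul (hi _ _)) ((hi _ _).fun_mul (hi _ _)), pd_mul _ (hi _ _) (hi _ _),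
      pd_mul _ (hi _ _) (hi _ _)]
    simp only [gInv_of_eq_diagonal hη, hg.pd_gInv_of_eq_diagonal hx hη]
    simp [sgn]; ring
  have hsD : HasFDerivAt (fun y => Real.sqrt (D y)) ((1 / (2 * Real.sqrt (D x))) • fderiv ℝ D x) x :=
    hDd.hasFDerivAt.sqrt (by rw [hDx]; norm_num)
  have hps : pd 1 (fun y => Real.sqrt (D y)) x = 1 / 2 * pd 1 D x := by
    rw [pd, hsD.fderiv, hDx]; simp [pd]
  have hsd : DifferentiableAt ℝ (fun y => Real.sqrt (D y)) x := hsD.differentiableAt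
  have h0 : nullDeriv g s = fun y => (-(gInv g y 0 0 * pd 0 (areaSq g) y
      + gInv g y 0 1 * pd 1 (areaSq g) y)) + (s * Real.sqrt (D y)) * pd 1 (areaSq g) y := by
    ext y; simp only [nullDeriv, hD, sq]
  rw [h0, pd_add, pd_neg, pd_add, pd_mul _ (hi _ _) (hA _), pd_mul _ (hi _ _) (hA _),
    pd_mul _ (hsd.const_mul s) (hA _), pd_const_mul _ _ hsd, hps, hpD, hDx]
  · simp only [gInv_of_eq_diagonal hη, hg.pd_gInv_of_eq_diagonal hx hη]
    simp [sgn]; ring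
  · exact (hi _ _).fun_mul (hA _)
  · exact (hi _ _).fun_mul (hA _)
  · exact (((hi _ _).fun_mul (hA _)).fun_add ((hi _ _).fun_mul (hA _))).fun_neg
  · exact (hsd.const_mul s).fun_mul (hA _)

end IsRegularOn

end

/-! ### The constraint identity for the null derivative. -/

section

open Filter Topology

/-- Christoffel symbols at a point where the metric is Minkowskian, in terms of the first
derivatives `d ρ μ ν = ∂_ρ g_{μν}`. -/
def christoffelJet (d : Fin 4 → Fin 4 → Fin 4 → ℝ) (l μ ν : Fin 4) : ℝ :=
  (1 / 2) * (sgn l * (d μ l ν + d ν l μ - d l μ ν))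

/-- Derivatives of Christoffel symbols at a point where the metric is Minkowskian, in terms of
the first and second derivatives of the metric. -/
def dChristoffelJet (d : Fin 4 → Fin 4 → Fin 4 → ℝ) (dd : Fin 4 → Fin 4 → Fin 4 → Fin 4 → ℝ)
    (k l μ ν : Fin 4) : ℝ :=
  (1 / 2) * (sgn l * (dd k μ l ν + dd k ν l μ - dd k l μ ν)
    - ∑ σ, sgn l * sgn σ * d k l σ * (d μ σ ν + d ν σ μ - d σ μ ν))

/-- The Ricci tensor at a point where the metric is Minkowskian. -/
def ricciJet (d : Fin 4 → Fin 4 → Fin 4 → ℝ) (dd : Fin 4 → Fin 4 → Fin 4 → Fin 4 → ℝ)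
    (μ ν : Fin 4) : ℝ :=
  (∑ l, dChristoffelJet d dd l l μ ν) - (∑ l, dChristoffelJet d dd ν l l μ)
    + (∑ l, ∑ σ, christoffelJet d l l σ * christoffelJet d σ μ ν)
    - ∑ l, ∑ σ, christoffelJet d l ν σ * christoffelJet d σ l μ

/-- The coefficient of the linear term in the evolution of `nullDeriv` along a slice, in terms of
the first derivatives of the metric in an adapted orthonormal frame. -/
def driftJet (d : Fin 4 → Fin 4 → Fin 4 → ℝ) (s : ℝ) : ℝ :=
  1 / 2 * d 0 1 1 + s / 2 * d 1 0 0 - d 1 0 1 + 1 / 4 * (d 0 2 2 + d 0 3 3)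
    + 3 / 4 * s * (d 1 2 2 + d 1 3 3)

section Jets

variable (d : Fin 4 → Fin 4 → Fin 4 → ℝ) (dd : Fin 4 → Fin 4 → Fin 4 → Fin 4 → ℝ)

/-- The left side is `s ∂₁ (nullDeriv g s)` written in derivatives of the metric. On the right, the
sum of the diagonal Ricci components is `2 G₀₀`, and `R₀₁ = G₀₁` because `g₀₁ = 0`; in this
combination the second time derivatives cancel. The remaining quadratic terms split into a multiple
of the null derivative and negative squares: those of the twist `∂₀ g₁ₐ - ∂₁ g₀ₐ`, and those of the
derivative of the orbit metric along `E₀ + s E₁`. -/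
lemma ricciJet_identity (hd2 : ∀ μ ν, d 2 μ ν = 0) (hd3 : ∀ μ ν, d 3 μ ν = 0)
    (hds : ∀ l μ ν, d l μ ν = d l ν μ)
    (hdd2 : ∀ l μ ν, dd l 2 μ ν = 0) (hdd3 : ∀ l μ ν, dd l 3 μ ν = 0)
    (hddc : ∀ k l μ ν, dd k l μ ν = dd l k μ ν) (hdds : ∀ k l μ ν, dd k l μ ν = dd k l ν μ)
    (s : ℝ) (hs : s ^ 2 = 1) :
    s * (d 1 0 0 * (d 0 2 2 + d 0 3 3) - d 1 0 1 * (d 1 2 2 + d 1 3 3)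
        + s / 2 * (d 1 0 0 - d 1 1 1) * (d 1 2 2 + d 1 3 3)
        + (dd 1 0 2 2 + dd 1 0 3 3 + d 0 2 2 * d 1 3 3 + d 1 2 2 * d 0 3 3
          - 2 * d 1 2 3 * d 0 2 3)
        + s * (dd 1 1 2 2 + dd 1 1 3 3 + 2 * d 1 2 2 * d 1 3 3 - 2 * d 1 2 3 * d 1 2 3))
      = driftJet d s * (d 0 2 2 + d 0 3 3 + s * (d 1 2 2 + d 1 3 3))
        - (ricciJet d dd 0 0 + ricciJet d dd 1 1 + ricciJet d dd 2 2 + ricciJet d dd 3 3)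
        - 2 * s * ricciJet d dd 0 1
        - 1 / 2 * ((d 0 1 2 - d 1 0 2) ^ 2 + (d 0 1 3 - d 1 0 3) ^ 2)
        - 1 / 4 * ((d 0 2 2 + s * d 1 2 2) ^ 2 + 2 * (d 0 2 3 + s * d 1 2 3) ^ 2
          + (d 0 3 3 + s * d 1 3 3) ^ 2) := by
  have hdd2' : ∀ l μ ν, dd 2 l μ ν = 0 := fun l μ ν => by rw [hddc, hdd2]
  have hdd3' : ∀ l μ ν, dd 3 l μ ν = 0 := fun l μ ν => by rw [hddc, hdd3]
  simp only [driftJet, ricciJet, dChristoffelJet, christoffelJet, Fin.sum_univ_four, hd2, hd3, hdd2, hdd3,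
    hdd2', hdd3', hddc 1 0, hds _ 1 0, hds _ 2 0, hds _ 3 0, hds _ 2 1, hds _ 3 1, hds _ 3 2,
    hdds _ _ 1 0]
  simp only [sgn, Matrix.cons_val_zero, Matrix.cons_val_one, Matrix.cons_val, zero_mul, mul_zero,
    add_zero, zero_add, sub_zero, zero_sub, sub_self]
  ring_nf
  simp only [hs]
  ring

end Jets

namespace IsRegularOn

variable {g : MetricField} {U : Set Point} {x : Point}

lemma ricci_of_eq_diagonal (hg : IsRegularOn g U) (hx : x ∈ U) (hη : g x = Matrix.diagonal sgn)
    (μ ν : Fin 4) :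
    ricci g μ ν x = ricciJet (fun l α β => pd l (fun y => g y α β) x)
      (fun k l α β => pd k (pd l (fun y => g y α β)) x) μ ν := by
  simp only [ricci, ricciJet, dChristoffelJet, christoffelJet,
    hg.pd_christoffel_of_eq_diagonal hx hη, christoffel_of_eq_diagonal hη]

/-- Dropping the squares in `ricciJet_identity` turns it into an inequality with the favourable sign
for both values of `s`. -/
lemma nullDeriv_evolution_of_eq_diagonal (hg : IsRegularOn g U) (hx : x ∈ U)
    (hη : g x = Matrix.diagonal sgn) (s : ℝ) (hs : s ^ 2 = 1) :
    s * pd 1 (nullDeriv g s) x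
      ≤ driftJet (fun l α β => pd l (fun y => g y α β) x) s * nullDeriv g s x
        - 2 * (einstein g 0 0 x + s * einstein g 0 1 x) := by
  have hid := ricciJet_identity (fun l α β => pd l (fun y => g y α β) x)
    (fun k l α β => pd k (pd l (fun y => g y α β)) x) (hg.pd_two x hx) (hg.pd_three x hx)
    (fun l μ ν => hg.pd_symm hx l μ ν) (fun l μ ν => hg.pd_pd_two hx l μ ν)
    (fun l μ ν => hg.pd_pd_three hx l μ ν) (fun k l μ ν => pd_comm k l (hg.smooth x hx μ ν))
    (fun k l μ ν => pd_congr k ((hg.eventually_mem hx).mono fun y hy => hg.pd_symm hy l μ ν)) s hs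
  simp only [← hg.ricci_of_eq_diagonal hx hη] at hid
  have hW : ∀ k, pd k (areaSq g) x = pd k (fun y => g y 2 2) x + pd k (fun y => g y 3 3) x := by
    intro k; rw [hg.pd_areaSq hx, hη]; simp [sgn]
  have hN : nullDeriv g s x = pd 0 (fun y => g y 2 2) x + pd 0 (fun y => g y 3 3) x
      + s * (pd 1 (fun y => g y 2 2) x + pd 1 (fun y => g y 3 3) x) := by
    simp only [nullDeriv, hW, gInv_of_eq_diagonal hη]; simp [sgn]
  have hE0 : einstein g 0 0 x
      = (ricci g 0 0 x + ricci g 1 1 x + ricci g 2 2 x + ricci g 3 3 x) / 2 := by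
    simp only [einstein, scalarCurv, gInv_of_eq_diagonal hη, hη, Fin.sum_univ_four]
    simp [sgn]; ring
  have hE1 : einstein g 0 1 x = ricci g 0 1 x := by
    simp [einstein, hη]
  rw [hg.pd_one_nullDeriv_of_eq_diagonal hx hη, hN, hE0, hE1, hg.pd_pd_areaSq hx hη,
    hg.pd_pd_areaSq hx hη, hW, hW]
  have hp : ∀ a b p q r : ℝ, 0 ≤ 1 / 2 * (a ^ 2 + b ^ 2) + 1 / 4 * (p ^ 2 + 2 * q ^ 2 + r ^ 2) :=
    fun a b p q r => by positivity
  have hsq := hp (pd 0 (fun y => g y 1 2) x - pd 1 (fun y => g y 0 2) x)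
    (pd 0 (fun y => g y 1 3) x - pd 1 (fun y => g y 0 3) x)
    (pd 0 (fun y => g y 2 2) x + s * pd 1 (fun y => g y 2 2) x)
    (pd 0 (fun y => g y 2 3) x + s * pd 1 (fun y => g y 2 3) x)
    (pd 0 (fun y => g y 3 3) x + s * pd 1 (fun y => g y 3 3) x)
  linarith only [hid, hsq]

end IsRegularOn

end

section

open Filter Topology Matrix

/-! ### Affine changes of coordinates -/

/-- The affine change of coordinates `z ↦ x₀ + L z`. -/
def affineMap (x₀ : Point) (L : Matrix (Fin 4) (Fin 4) ℝ) (z : Point) : Point := x₀ + L *ᵥ z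

/-- The pullback of a metric under `z ↦ x₀ + L z`. -/
def pullback (g : MetricField) (x₀ : Point) (L : Matrix (Fin 4) (Fin 4) ℝ) : MetricField :=
  fun z => Lᵀ * g (affineMap x₀ L z) * L

variable {g : MetricField} {U : Set Point} {x₀ z : Point} {L : Matrix (Fin 4) (Fin 4) ℝ}

lemma affineMap_zero : affineMap x₀ L 0 = x₀ := by simp [affineMap]

lemma hasFDerivAt_affineMap :
    HasFDerivAt (affineMap x₀ L) (LinearMap.toContinuousLinearMap (Matrix.mulVecLin L)) z :=
  (LinearMap.toContinuousLinearMap (Matrix.mulVecLin L)).hasFDerivAt.const_add x₀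

lemma contDiff_affineMap : ContDiff ℝ ∞ (affineMap x₀ L) :=
  contDiff_const.add (LinearMap.toContinuousLinearMap (Matrix.mulVecLin L)).contDiff

lemma pd_comp_affineMap {F : Point → ℝ} (μ : Fin 4)
    (hF : DifferentiableAt ℝ F (affineMap x₀ L z)) :
    pd μ (fun y => F (affineMap x₀ L y)) z = ∑ ρ, L ρ μ * pd ρ F (affineMap x₀ L z) := by
  have h := hF.hasFDerivAt.comp z hasFDerivAt_affineMap
  rw [pd, show (fun y => F (affineMap x₀ L y)) = F ∘ affineMap x₀ L from rfl, h.fderiv,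
    ContinuousLinearMap.comp_apply, fderiv_apply_eq_sum_pd]
  simp [unitVec]

lemma pullback_apply (μ ν : Fin 4) :
    pullback g x₀ L z μ ν = ∑ α, ∑ β, L α μ * L β ν * g (affineMap x₀ L z) α β := by
  simp only [pullback, Matrix.mul_apply, Matrix.transpose_apply, Finset.sum_mul]
  rw [Finset.sum_comm]
  exact Finset.sum_congr rfl fun α _ => Finset.sum_congr rfl fun β _ => by ring

namespace IsRegularOn

lemma pd_pullback (hg : IsRegularOn g U) (hz : affineMap x₀ L z ∈ U) (l μ ν : Fin 4) :
    pd l (fun y => pullback g x₀ L y μ ν) z = ∑ ρ, ∑ α, ∑ β, L ρ l * L α μ * L β ν *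
      pd ρ (fun y => g y α β) (affineMap x₀ L z) := by
  have h1 : (fun y => pullback g x₀ L y μ ν)
      = fun y => (fun x => ∑ α, ∑ β, L α μ * L β ν * g x α β) (affineMap x₀ L y) := by
    ext y; exact pullback_apply μ ν
  have hd : ∀ α β, DifferentiableAt ℝ (fun x => L α μ * L β ν * g x α β) (affineMap x₀ L z) :=
    fun α β => (hg.differentiableAt hz α β).const_mul _
  rw [h1, pd_comp_affineMap _
    (DifferentiableAt.fun_sum fun α _ => DifferentiableAt.fun_sum fun β _ => hd α β)]
  refine Finset.sum_congr rfl fun ρ _ => ?_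
  rw [pd_sum _ _ fun α _ => DifferentiableAt.fun_sum fun β _ => hd α β, Finset.mul_sum]
  refine Finset.sum_congr rfl fun α _ => ?_
  rw [pd_sum _ _ fun β _ => hd α β, Finset.mul_sum]
  refine Finset.sum_congr rfl fun β _ => ?_
  rw [pd_const_mul _ _ (hg.differentiableAt hz α β)]; ring

/-- Triangularity makes columns 2 and 3 of `L` combinations of `∂₂` and `∂₃` alone, so the new
coordinates have the same invariance directions. -/
lemma pullback (hg : IsRegularOn g U) (hL : IsUnit L.det) (hLt : ∀ i j, i < j → L i j = 0) :
    IsRegularOn (pullback g x₀ L) (affineMap x₀ L ⁻¹' U) where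
  isOpen := hg.isOpen.preimage contDiff_affineMap.continuous
  smooth z hz μ ν := by
    simp only [pullback_apply]
    refine ContDiffAt.sum fun α _ => ContDiffAt.sum fun β _ => contDiffAt_const.mul ?_
    exact (hg.smooth _ hz α β).comp z contDiff_affineMap.contDiffAt
  det_ne_zero z hz := by
    simp only [EinsteinVlasov.pullback, Matrix.det_mul, Matrix.det_transpose]
    exact mul_ne_zero (mul_ne_zero hL.ne_zero (hg.det_ne_zero _ hz)) hL.ne_zero
  symm z hz μ ν := by
    rw [pullback_apply, pullback_apply, Finset.sum_comm]
    refine Finset.sum_congr rfl fun α _ => Finset.sum_congr rfl fun β _ => ?_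
    rw [hg.symm _ hz β α]; ring
  pd_two z hz μ ν := by
    rw [hg.pd_pullback hz, Fin.sum_univ_four]
    simp [hLt 0 2 (by decide), hLt 1 2 (by decide), hg.pd_two _ hz, hg.pd_three _ hz]
  pd_three z hz μ ν := by
    rw [hg.pd_pullback hz, Fin.sum_univ_four]
    simp [hLt 0 3 (by decide), hLt 1 3 (by decide), hLt 2 3 (by decide), hg.pd_three _ hz]

end IsRegularOn

/-- Christoffel symbols with lower second index `ν`, as a matrix. -/
def christoffelMatrix (g : MetricField) (ν : Fin 4) (x : Point) : Matrix (Fin 4) (Fin 4) ℝ :=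
  Matrix.of fun l μ => christoffel g l μ ν x

/-- Derivatives of Christoffel symbols with lower second index `ν`, as a matrix. -/
def dChristoffelMatrix (g : MetricField) (k ν : Fin 4) (x : Point) : Matrix (Fin 4) (Fin 4) ℝ :=
  Matrix.of fun l μ => pd k (christoffel g l μ ν) x

/-- Christoffel symbols of the first kind, as a matrix. -/
def lowerChristoffelMatrix (g : MetricField) (ν : Fin 4) (x : Point) :
    Matrix (Fin 4) (Fin 4) ℝ :=
  Matrix.of fun σ μ => pd μ (fun y => g y σ ν) x + pd ν (fun y => g y σ μ) x
    - pd σ (fun y => g y μ ν) x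

lemma christoffelMatrix_eq (g : MetricField) (ν : Fin 4) (x : Point) :
    christoffelMatrix g ν x = (1 / 2 : ℝ) • ((g x)⁻¹ * lowerChristoffelMatrix g ν x) := by
  ext l μ
  simp [christoffelMatrix, christoffel, lowerChristoffelMatrix, Matrix.mul_apply, gInv]

lemma pullback_inv :
    (pullback g x₀ L z)⁻¹ = L⁻¹ * (g (affineMap x₀ L z))⁻¹ * L⁻¹ᵀ := by
  rw [pullback, Matrix.mul_inv_rev, Matrix.mul_inv_rev, Matrix.transpose_nonsing_inv,
    Matrix.mul_assoc]

namespace IsRegularOn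

lemma lowerChristoffelMatrix_pullback (hg : IsRegularOn g U) (hz : affineMap x₀ L z ∈ U)
    (ν : Fin 4) : lowerChristoffelMatrix (EinsteinVlasov.pullback g x₀ L) ν z
      = ∑ γ, L γ ν • (Lᵀ * lowerChristoffelMatrix g γ (affineMap x₀ L z) * L) := by
  ext σ μ
  simp only [lowerChristoffelMatrix, Matrix.of_apply, hg.pd_pullback hz, Matrix.sum_apply,
    Matrix.smul_apply, Matrix.mul_apply, Matrix.transpose_apply, smul_eq_mul]
  generalize affineMap x₀ L z = x
  simp only [Fin.sum_univ_four]
  ring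

/-- The coordinate change is affine, so the inhomogeneous term of the transformation law is absent.
With one lower index singled out, the symbols form a matrix that transforms by conjugation,
contracted with `L` in that index. -/
lemma christoffelMatrix_pullback (hg : IsRegularOn g U) (hL : IsUnit L.det)
    (hz : affineMap x₀ L z ∈ U) (ν : Fin 4) :
    christoffelMatrix (EinsteinVlasov.pullback g x₀ L) ν z
      = ∑ γ, L γ ν • (L⁻¹ * christoffelMatrix g γ (affineMap x₀ L z) * L) := by
  have h1 : L⁻¹ᵀ * Lᵀ = 1 := by
    rw [← Matrix.transpose_mul, Matrix.mul_nonsing_inv _ hL, Matrix.transpose_one]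
  simp only [christoffelMatrix_eq, hg.lowerChristoffelMatrix_pullback hz, pullback_inv,
    Matrix.mul_sum, Finset.smul_sum]
  refine Finset.sum_congr rfl fun γ _ => ?_
  simp only [Matrix.mul_smul, Matrix.smul_mul, smul_comm (L γ ν) (1 / 2 : ℝ)]
  congr 2
  calc _ = L⁻¹ * (g (affineMap x₀ L z))⁻¹ * (L⁻¹ᵀ * Lᵀ)
        * (lowerChristoffelMatrix g γ (affineMap x₀ L z) * L) := by
        simp only [Matrix.mul_assoc]
    _ = _ := by rw [h1]; simp only [Matrix.mul_assoc, Matrix.mul_one]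

lemma dChristoffelMatrix_pullback (hg : IsRegularOn g U) (hL : IsUnit L.det)
    (hz : affineMap x₀ L z ∈ U) (k ν : Fin 4) :
    dChristoffelMatrix (EinsteinVlasov.pullback g x₀ L) k ν z
      = ∑ κ, L κ k • ∑ γ, L γ ν • (L⁻¹ * dChristoffelMatrix g κ γ (affineMap x₀ L z) * L) := by
  ext l μ
  have hopen : IsOpen (affineMap x₀ L ⁻¹' U) := hg.isOpen.preimage contDiff_affineMap.continuous
  have h1 : christoffel (EinsteinVlasov.pullback g x₀ L) l μ ν =ᶠ[𝓝 z]
      fun y => (fun x => ∑ γ, ∑ β, ∑ α, L γ ν * L⁻¹ l α * L β μ * christoffel g α β γ x)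
        (affineMap x₀ L y) := by
    filter_upwards [hopen.mem_nhds hz] with y hy
    have := congrFun (congrFun (hg.christoffelMatrix_pullback hL hy ν) l) μ
    simp only [christoffelMatrix, Matrix.sum_apply, Matrix.smul_apply, Matrix.mul_apply,
      Matrix.of_apply, smul_eq_mul] at this
    rw [this]
    refine Finset.sum_congr rfl fun γ _ => ?_
    rw [Finset.mul_sum]
    refine Finset.sum_congr rfl fun β _ => ?_
    rw [Finset.sum_mul, Finset.mul_sum]
    exact Finset.sum_congr rfl fun α _ => by ring
  have hd : ∀ α β γ, DifferentiableAt ℝ (christoffel g α β γ) (affineMap x₀ L z) := fun α β γ =>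
    (hg.contDiffAt_christoffel hz α β γ).differentiableAt (by norm_num)
  have hd1 : ∀ α β γ, DifferentiableAt ℝ
      (fun x => L γ ν * L⁻¹ l α * L β μ * christoffel g α β γ x) (affineMap x₀ L z) :=
    fun α β γ => (hd α β γ).const_mul _
  have hd2 : ∀ β γ, DifferentiableAt ℝ
      (fun x => ∑ α, L γ ν * L⁻¹ l α * L β μ * christoffel g α β γ x) (affineMap x₀ L z) :=
    fun β γ => DifferentiableAt.fun_sum fun α _ => hd1 α β γ
  have hd3 : ∀ γ, DifferentiableAt ℝ
      (fun x => ∑ β, ∑ α, L γ ν * L⁻¹ l α * L β μ * christoffel g α β γ x) (affineMap x₀ L z) :=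
    fun γ => DifferentiableAt.fun_sum fun β _ => hd2 β γ
  simp only [dChristoffelMatrix, Matrix.sum_apply, Matrix.smul_apply, Matrix.mul_apply,
    Matrix.of_apply, smul_eq_mul]
  rw [pd_congr k h1, pd_comp_affineMap _ (DifferentiableAt.fun_sum fun γ _ => hd3 γ)]
  refine Finset.sum_congr rfl fun κ _ => ?_
  rw [pd_sum _ _ fun γ _ => hd3 γ]
  refine congrArg _ (Finset.sum_congr rfl fun γ _ => ?_)
  rw [pd_sum _ _ fun β _ => hd2 β γ, Finset.mul_sum]
  refine Finset.sum_congr rfl fun β _ => ?_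
  rw [pd_sum _ _ fun α _ => hd1 α β γ, Finset.sum_mul, Finset.mul_sum]
  refine Finset.sum_congr rfl fun α _ => ?_
  rw [pd_const_mul _ _ (hd α β γ)]; ring

/-- This form makes covariance visible, since only traces and one contracted index occur. The
symmetry of the symbols in their lower indices brings every factor to the matrix convention. -/
lemma ricci_eq_trace (hg : IsRegularOn g U) {x : Point} (hx : x ∈ U) (μ ν : Fin 4) :
    ricci g μ ν x = (∑ l, dChristoffelMatrix g l ν x l μ)
      - (dChristoffelMatrix g ν μ x).trace
      + (∑ σ, (christoffelMatrix g σ x).trace * christoffelMatrix g ν x σ μ)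
      - (christoffelMatrix g ν x * christoffelMatrix g μ x).trace := by
  simp only [ricci, Matrix.trace, Matrix.diag, dChristoffelMatrix, christoffelMatrix,
    Matrix.mul_apply, Matrix.of_apply, Finset.sum_mul]
  rw [Finset.sum_comm (f := fun σ l => christoffel g l l σ x * christoffel g σ μ ν x)]
  simp only [fun l σ => hg.christoffel_symm hx l ν σ]

end IsRegularOn

end

/-! ### Covariance of the curvature under affine maps. -/

section

open Filter Topology Matrix

variable {g : MetricField} {U : Set Point} {x₀ z : Point} {L : Matrix (Fin 4) (Fin 4) ℝ}

lemma trace_conj (hL : IsUnit L.det) (X : Matrix (Fin 4) (Fin 4) ℝ) :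
    (L⁻¹ * X * L).trace = X.trace := by
  rw [Matrix.trace_mul_comm, ← Matrix.mul_assoc, Matrix.mul_nonsing_inv _ hL, Matrix.one_mul]

lemma sum_mul_conj_apply (hL : IsUnit L.det) (X : Matrix (Fin 4) (Fin 4) ℝ) (κ μ : Fin 4) :
    ∑ l, L κ l * (L⁻¹ * X * L) l μ = ∑ α, X κ α * L α μ := by
  rw [← Matrix.mul_apply, ← Matrix.mul_apply, Matrix.mul_assoc, ← Matrix.mul_assoc,
    Matrix.mul_nonsing_inv _ hL, Matrix.one_mul]

namespace IsRegularOn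

/-- For affine maps each of the four terms is covariant by itself: the conjugations disappear under
the traces (`trace_conj`), or `L⁻¹` cancels against the contracted index (`sum_mul_conj_apply`). -/
lemma ricci_pullback (hg : IsRegularOn g U) (hL : IsUnit L.det)
    (hLt : ∀ i j, i < j → L i j = 0) (hz : affineMap x₀ L z ∈ U) (μ ν : Fin 4) :
    ricci (EinsteinVlasov.pullback g x₀ L) μ ν z
      = ∑ α, ∑ β, L α μ * L β ν * ricci g α β (affineMap x₀ L z) := by
  rw [(hg.pullback hL hLt).ricci_eq_trace (x := z) hz]
  simp only [hg.ricci_eq_trace hz, hg.dChristoffelMatrix_pullback hL hz,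
    hg.christoffelMatrix_pullback hL hz]
  generalize affineMap x₀ L z = x
  have t1 : ∑ l, (∑ κ, L κ l • ∑ γ, L γ ν • (L⁻¹ * dChristoffelMatrix g κ γ x * L)) l μ
      = ∑ α, ∑ β, L α μ * L β ν * ∑ l, dChristoffelMatrix g l β x l α := by
    simp only [Matrix.sum_apply, Matrix.smul_apply, smul_eq_mul]
    calc _ = ∑ κ, ∑ γ, L γ ν * ∑ l, L κ l * (L⁻¹ * dChristoffelMatrix g κ γ x * L) l μ := by
          rw [Finset.sum_comm]
          refine Finset.sum_congr rfl fun κ _ => ?_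
          simp only [Finset.mul_sum]
          rw [Finset.sum_comm]
          exact Finset.sum_congr rfl fun γ _ => Finset.sum_congr rfl fun l _ => by ring
      _ = ∑ κ, ∑ γ, ∑ α, L α μ * L γ ν * dChristoffelMatrix g κ γ x κ α := by
          refine Finset.sum_congr rfl fun κ _ => Finset.sum_congr rfl fun γ _ => ?_
          rw [sum_mul_conj_apply hL, Finset.mul_sum]
          exact Finset.sum_congr rfl fun α _ => by ring
      _ = ∑ α, ∑ γ, ∑ κ, L α μ * L γ ν * dChristoffelMatrix g κ γ x κ α := by
          rw [Finset.sum_comm]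
          simp_rw [Finset.sum_comm (s := Finset.univ (α := Fin 4)) (t := Finset.univ (α := Fin 4))
            (f := fun κ α => L α μ * L _ ν * dChristoffelMatrix g κ _ x κ α)]
          rw [Finset.sum_comm]
      _ = _ := by simp only [Finset.mul_sum]
  have t2 : (∑ κ, L κ ν • ∑ γ, L γ μ • (L⁻¹ * dChristoffelMatrix g κ γ x * L)).trace
      = ∑ α, ∑ β, L α μ * L β ν * (dChristoffelMatrix g β α x).trace := by
    simp only [Matrix.trace_sum, Matrix.trace_smul, trace_conj hL, smul_eq_mul, Finset.mul_sum]
    rw [Finset.sum_comm]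
    exact Finset.sum_congr rfl fun α _ => Finset.sum_congr rfl fun β _ => by ring
  have t3 : ∑ σ, (∑ γ, L γ σ • (L⁻¹ * christoffelMatrix g γ x * L)).trace
        * (∑ γ, L γ ν • (L⁻¹ * christoffelMatrix g γ x * L)) σ μ
      = ∑ α, ∑ β, L α μ * L β ν
        * ∑ σ, (christoffelMatrix g σ x).trace * christoffelMatrix g β x σ α := by
    simp only [Matrix.trace_sum, Matrix.trace_smul, trace_conj hL, smul_eq_mul, Matrix.sum_apply,
      Matrix.smul_apply]
    calc _ = ∑ δ, ∑ γ, (christoffelMatrix g δ x).trace * L γ ν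
          * ∑ σ, L δ σ * (L⁻¹ * christoffelMatrix g γ x * L) σ μ := by
          simp only [Finset.sum_mul_sum]
          rw [Finset.sum_comm]
          refine Finset.sum_congr rfl fun δ _ => ?_
          rw [Finset.sum_comm]
          refine Finset.sum_congr rfl fun γ _ => ?_
          rw [Finset.mul_sum]
          exact Finset.sum_congr rfl fun σ _ => by ring
      _ = ∑ δ, ∑ γ, ∑ α, L α μ * L γ ν
          * ((christoffelMatrix g δ x).trace * christoffelMatrix g γ x δ α) := by
          refine Finset.sum_congr rfl fun δ _ => Finset.sum_congr rfl fun γ _ => ?_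
          rw [sum_mul_conj_apply hL, Finset.mul_sum]
          exact Finset.sum_congr rfl fun α _ => by ring
      _ = _ := by
          simp only [Finset.mul_sum]
          rw [Finset.sum_comm_cycle]
          exact Finset.sum_congr rfl fun α _ => Finset.sum_comm
  have t4 : ((∑ γ, L γ ν • (L⁻¹ * christoffelMatrix g γ x * L))
        * (∑ γ, L γ μ • (L⁻¹ * christoffelMatrix g γ x * L))).trace
      = ∑ α, ∑ β, L α μ * L β ν * (christoffelMatrix g β x * christoffelMatrix g α x).trace := by
    have hc : ∀ X Y : Matrix (Fin 4) (Fin 4) ℝ,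
        (L⁻¹ * X * L * (L⁻¹ * Y * L)).trace = (X * Y).trace := by
      intro X Y
      rw [← trace_conj hL (X * Y)]
      congr 1
      calc _ = L⁻¹ * X * (L * L⁻¹) * Y * L := by simp only [Matrix.mul_assoc]
        _ = _ := by rw [Matrix.mul_nonsing_inv _ hL]; simp only [Matrix.mul_assoc, Matrix.one_mul]
    simp only [Finset.sum_mul, Finset.mul_sum, Matrix.smul_mul, Matrix.mul_smul, Matrix.trace_sum,
      Matrix.trace_smul, hc, smul_eq_mul]
    exact Finset.sum_congr rfl fun α _ => Finset.sum_congr rfl fun β _ => by ring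
  rw [t1, t2, t3, t4]
  simp only [← Finset.sum_add_distrib, ← Finset.sum_sub_distrib]
  exact Finset.sum_congr rfl fun α _ => Finset.sum_congr rfl fun β _ => by ring

end IsRegularOn

lemma scalarCurv_eq_trace (g : MetricField) (x : Point) :
    scalarCurv g x = ((g x)⁻¹ * (Matrix.of fun μ ν => ricci g μ ν x)ᵀ).trace := by
  simp [scalarCurv, Matrix.trace, Matrix.mul_apply, gInv]

lemma sum_sum_eq_conj (X : Matrix (Fin 4) (Fin 4) ℝ) (μ ν : Fin 4) :
    ∑ α, ∑ β, L α μ * L β ν * X α β = (Lᵀ * X * L) μ ν := by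
  simp only [Matrix.mul_apply, Matrix.transpose_apply, Finset.sum_mul]
  rw [Finset.sum_comm]
  exact Finset.sum_congr rfl fun α _ => Finset.sum_congr rfl fun β _ => by ring

namespace IsRegularOn

lemma einstein_pullback (hg : IsRegularOn g U) (hL : IsUnit L.det)
    (hLt : ∀ i j, i < j → L i j = 0) (hz : affineMap x₀ L z ∈ U) (μ ν : Fin 4) :
    einstein (EinsteinVlasov.pullback g x₀ L) μ ν z
      = ∑ α, ∑ β, L α μ * L β ν * einstein g α β (affineMap x₀ L z) := by
  have hR : (Matrix.of fun μ ν => ricci (EinsteinVlasov.pullback g x₀ L) μ ν z)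
      = Lᵀ * (Matrix.of fun μ ν => ricci g μ ν (affineMap x₀ L z)) * L := by
    ext μ ν
    rw [← sum_sum_eq_conj, Matrix.of_apply, hg.ricci_pullback hL hLt hz]
    rfl
  have h1 : L⁻¹ᵀ * Lᵀ = 1 := by
    rw [← Matrix.transpose_mul, Matrix.mul_nonsing_inv _ hL, Matrix.transpose_one]
  have hS : scalarCurv (EinsteinVlasov.pullback g x₀ L) z = scalarCurv g (affineMap x₀ L z) := by
    rw [scalarCurv_eq_trace, scalarCurv_eq_trace, hR, pullback_inv]
    generalize (Matrix.of fun μ ν => ricci g μ ν (affineMap x₀ L z)) = X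
    rw [← trace_conj hL ((g (affineMap x₀ L z))⁻¹ * Xᵀ)]
    congr 1
    simp only [Matrix.transpose_mul, Matrix.transpose_transpose]
    calc _ = L⁻¹ * (g (affineMap x₀ L z))⁻¹ * (L⁻¹ᵀ * Lᵀ) * Xᵀ * L := by
          simp only [Matrix.mul_assoc]
      _ = _ := by rw [h1]; simp only [Matrix.mul_assoc, Matrix.mul_one]
  rw [einstein, hg.ricci_pullback hL hLt hz, hS, pullback_apply, Finset.mul_sum,
    ← Finset.sum_sub_distrib]
  refine Finset.sum_congr rfl fun α _ => ?_
  rw [Finset.mul_sum, ← Finset.sum_sub_distrib]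
  refine Finset.sum_congr rfl fun β _ => ?_
  rw [einstein]; ring

end IsRegularOn

end

section

open Filter Topology Matrix

/-! ### Adapted orthonormal frames -/

/-- The columns of `L` form an orthonormal frame for the form `G`, adapted to the flag given by the
coordinates: `L` is lower triangular with positive diagonal. -/
structure IsAdaptedFrame (G L : Matrix (Fin 4) (Fin 4) ℝ) : Prop where
  lower : ∀ i j, i < j → L i j = 0
  pos : ∀ i, 0 < L i i
  orthonormal : Lᵀ * G * L = Matrix.diagonal sgn

lemma diagonal_sgn_mul_self : Matrix.diagonal sgn * Matrix.diagonal sgn = 1 := by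
  rw [Matrix.diagonal_mul_diagonal, ← Matrix.diagonal_one]
  congr 1; ext i; fin_cases i <;> simp [sgn]

namespace IsAdaptedFrame

variable {G L : Matrix (Fin 4) (Fin 4) ℝ}

lemma isUnit_det (h : IsAdaptedFrame G L) : IsUnit L.det := by
  rw [Matrix.det_of_isLowerTriangular L fun i j hij => h.lower i j hij]
  exact (Finset.prod_ne_zero_iff.2 fun i _ => (h.pos i).ne').isUnit

lemma inv_eq (h : IsAdaptedFrame G L) : G⁻¹ = L * Matrix.diagonal sgn * Lᵀ := by
  apply Matrix.inv_eq_left_inv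
  have h1 : Matrix.diagonal sgn * Lᵀ * G * L = 1 := by
    rw [Matrix.mul_assoc (Matrix.diagonal sgn), Matrix.mul_assoc (Matrix.diagonal sgn),
      h.orthonormal, diagonal_sgn_mul_self]
  rw [mul_eq_one_comm] at h1
  simpa only [Matrix.mul_assoc] using h1

lemma inv_apply (h : IsAdaptedFrame G L) (i j : Fin 4) :
    G⁻¹ i j = ∑ k, sgn k * L i k * L j k := by
  rw [h.inv_eq, Matrix.mul_apply]
  refine Finset.sum_congr rfl fun k _ => ?_
  rw [Matrix.mul_diagonal, Matrix.transpose_apply]; ring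

end IsAdaptedFrame

variable {g : MetricField} {U : Set Point} {x₀ x z : Point} {L : Matrix (Fin 4) (Fin 4) ℝ}

/-- Only the lower right two by two block of `L` acts on the orbit directions, and its determinant
is `L 2 2 * L 3 3`. -/
lemma areaSq_pullback (hLt : ∀ i j, i < j → L i j = 0) :
    areaSq (pullback g x₀ L) z = (L 2 2 * L 3 3) ^ 2 * areaSq g (affineMap x₀ L z) := by
  simp only [areaSq, pullback_apply, Fin.sum_univ_four]
  simp only [hLt 0 2 (by decide), hLt 1 2 (by decide), hLt 0 3 (by decide),
    hLt 1 3 (by decide), hLt 2 3 (by decide)]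
  ring

lemma gInv_eq_pullback (hL : IsUnit L.det) (μ ν : Fin 4) :
    gInv g (affineMap x₀ L z) μ ν
      = ∑ α, ∑ β, L μ α * L ν β * gInv (pullback g x₀ L) z α β := by
  have h1 : Lᵀ * L⁻¹ᵀ = 1 := by
    rw [← Matrix.transpose_mul, Matrix.nonsing_inv_mul _ hL, Matrix.transpose_one]
  have h2 : (g (affineMap x₀ L z))⁻¹ = L * (pullback g x₀ L z)⁻¹ * Lᵀ := by
    rw [pullback_inv]
    have h3 : L⁻¹ᵀ * Lᵀ = 1 := by
      rw [← Matrix.transpose_mul, Matrix.mul_nonsing_inv _ hL, Matrix.transpose_one]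
    calc _ = L * L⁻¹ * (g (affineMap x₀ L z))⁻¹ * (L⁻¹ᵀ * Lᵀ) := by
          rw [h3, Matrix.mul_nonsing_inv _ hL, Matrix.one_mul, Matrix.mul_one]
      _ = _ := by simp only [Matrix.mul_assoc]
  have h4 := sum_sum_eq_conj (L := Lᵀ) (pullback g x₀ L z)⁻¹ μ ν
  rw [Matrix.transpose_transpose] at h4
  simp only [gInv, Matrix.transpose_apply] at h4 ⊢
  rw [h4, h2]

namespace IsRegularOn

lemma pd_areaSq_two (hg : IsRegularOn g U) (hx : x ∈ U) : pd 2 (areaSq g) x = 0 := by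
  simp [hg.pd_areaSq hx, hg.pd_two x hx]

lemma pd_areaSq_three (hg : IsRegularOn g U) (hx : x ∈ U) : pd 3 (areaSq g) x = 0 := by
  simp [hg.pd_areaSq hx, hg.pd_three x hx]

lemma pd_areaSq_pullback (hg : IsRegularOn g U) (hLt : ∀ i j, i < j → L i j = 0)
    (hz : affineMap x₀ L z ∈ U) (k : Fin 4) :
    pd k (areaSq (EinsteinVlasov.pullback g x₀ L)) z = (L 2 2 * L 3 3) ^ 2
      * (L 0 k * pd 0 (areaSq g) (affineMap x₀ L z)
        + L 1 k * pd 1 (areaSq g) (affineMap x₀ L z)) := by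
  have hd := (hg.contDiffAt_areaSq hz).differentiableAt (by norm_num)
  rw [show areaSq (EinsteinVlasov.pullback g x₀ L) = fun z =>
    (fun x => (L 2 2 * L 3 3) ^ 2 * areaSq g x) (affineMap x₀ L z) from
    funext fun z => areaSq_pullback hLt, pd_comp_affineMap k (hd.const_mul _)]
  simp only [pd_const_mul _ _ hd, Fin.sum_univ_four, hg.pd_areaSq_two hz, hg.pd_areaSq_three hz]
  ring

/-- Positivity of `L 0 0` and `L 1 1` fixes the sign of the square root, so the two null directions
are not interchanged and the same `s` stands on both sides. -/
lemma nullDeriv_pullback (hg : IsRegularOn g U) (hL : IsUnit L.det)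
    (hLt : ∀ i j, i < j → L i j = 0) (hpos : ∀ i, 0 < L i i)
    (hz : affineMap x₀ L z ∈ U) (s : ℝ) :
    nullDeriv (EinsteinVlasov.pullback g x₀ L) s z
      = (L 2 2 * L 3 3) ^ 2 / L 0 0 * nullDeriv g s (affineMap x₀ L z) := by
  have hg' := hg.pullback (x₀ := x₀) hL hLt
  have hs := hg'.gInv_symm (x := z) hz 1 0
  have h00 := gInv_eq_pullback (g := g) (x₀ := x₀) (z := z) hL 0 0
  have h01 := gInv_eq_pullback (g := g) (x₀ := x₀) (z := z) hL 0 1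
  have h11 := gInv_eq_pullback (g := g) (x₀ := x₀) (z := z) hL 1 1
  simp only [Fin.sum_univ_four, hLt 0 1 (by decide), hLt 0 2 (by decide), hLt 1 2 (by decide),
    hLt 0 3 (by decide), hLt 1 3 (by decide), hs] at h00 h01 h11
  have hp := hpos 0
  have hp1 := hpos 1
  set i00 := gInv (EinsteinVlasov.pullback g x₀ L) z 0 0
  set i01 := gInv (EinsteinVlasov.pullback g x₀ L) z 0 1
  set i11 := gInv (EinsteinVlasov.pullback g x₀ L) z 1 1
  have hD : √(gInv g (affineMap x₀ L z) 0 1 ^ 2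
      - gInv g (affineMap x₀ L z) 0 0 * gInv g (affineMap x₀ L z) 1 1)
      = L 0 0 * L 1 1 * √(i01 ^ 2 - i00 * i11) := by
    rw [← Real.sqrt_sq (show 0 ≤ L 0 0 * L 1 1 by positivity), ← Real.sqrt_mul (sq_nonneg _), h00,
      h01, h11]
    congr 1
    ring
  simp only [nullDeriv, hg.pd_areaSq_pullback hLt hz, hD, hLt 0 1 (by decide)]
  rw [h00, h01]
  field_simp
  ring

lemma contDiffAt_nullDeriv (hg : IsRegularOn g U) (hx : x ∈ U)
    (hD : gInv g x 0 1 ^ 2 - gInv g x 0 0 * gInv g x 1 1 ≠ 0) (s : ℝ) :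
    ContDiffAt ℝ ∞ (nullDeriv g s) x := by
  have hi := hg.contDiffAt_gInv hx
  have hA := fun k => contDiffAt_pd k (hg.contDiffAt_areaSq hx)
  unfold nullDeriv
  exact (((hi _ _).mul (hA _)).add ((hi _ _).mul (hA _))).neg.add
    ((contDiffAt_const.mul ((((hi _ _).pow 2).sub ((hi _ _).mul (hi _ _))).sqrt hD)).mul (hA _))

end IsRegularOn

/-- The radicand in `nullDeriv` is thus a positive square. Hence `nullDeriv` is smooth, and its root
is `L 0 0 * L 1 1`. -/
lemma IsAdaptedFrame.discriminant (h : IsAdaptedFrame (g x) L) :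
    gInv g x 0 1 ^ 2 - gInv g x 0 0 * gInv g x 1 1 = (L 0 0 * L 1 1) ^ 2 := by
  simp only [gInv, h.inv_apply, Fin.sum_univ_four, h.lower 0 1 (by decide),
    h.lower 0 2 (by decide), h.lower 0 3 (by decide), h.lower 1 2 (by decide),
    h.lower 1 3 (by decide)]
  simp [sgn]; ring

/-- The coefficient of the linear term in the evolution of `nullDeriv` along a slice. -/
def drift (g : MetricField) (s : ℝ) (L : Matrix (Fin 4) (Fin 4) ℝ) (x : Point) : ℝ :=
  driftJet (fun l μ ν => ∑ ρ, ∑ α, ∑ β, L ρ l * L α μ * L β ν * pd ρ (fun y => g y α β) x) s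
    / L 1 1

/-- Pulling back by the constant matrix `L` makes the metric Minkowskian at the origin, where the
inequality is known. Only the value of the frame at `x` enters, so the frame never has to be
differentiated. The new `∂₁` is column 1 of `L`; its components along `∂₂` and `∂₃` are removed by
`h2` and `h3`. The sum on the right is `G(E₀, E₀ + s E₁)`. -/
lemma IsRegularOn.nullDeriv_evolution (hg : IsRegularOn g U) (hx : x ∈ U)
    (hL : IsAdaptedFrame (g x) L) (s : ℝ) (hs : s ^ 2 = 1)
    (h2 : pd 2 (nullDeriv g s) x = 0) (h3 : pd 3 (nullDeriv g s) x = 0) :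
    s * pd 1 (nullDeriv g s) x ≤ drift g s L x * nullDeriv g s x
      - 2 * L 0 0 / ((L 2 2 * L 3 3) ^ 2 * L 1 1)
        * ∑ α, ∑ β, L α 0 * (L β 0 + s * L β 1) * einstein g α β x := by
  have hu := hL.isUnit_det
  have hx0 : affineMap x L 0 = x := affineMap_zero
  have hz : affineMap x L 0 ∈ U := by rwa [hx0]
  have hg' := hg.pullback (x₀ := x) hu hL.lower
  have hη : EinsteinVlasov.pullback g x L 0 = Matrix.diagonal sgn := by
    rw [EinsteinVlasov.pullback, hx0, hL.orthonormal]
  have key := hg'.nullDeriv_evolution_of_eq_diagonal (x := 0) hz hη s hs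
  have hd : DifferentiableAt ℝ (nullDeriv g s) (affineMap x L 0) := by
    rw [hx0]
    refine (hg.contDiffAt_nullDeriv hx ?_ s).differentiableAt (by norm_num)
    rw [hL.discriminant]
    exact pow_ne_zero _ (mul_pos (hL.pos 0) (hL.pos 1)).ne'
  have hpd : pd 1 (nullDeriv (EinsteinVlasov.pullback g x L) s) 0
      = (L 2 2 * L 3 3) ^ 2 / L 0 0 * (L 1 1 * pd 1 (nullDeriv g s) x) := by
    rw [pd_congr 1 ((hg'.eventually_mem (x := 0) hz).mono fun y hy =>
      hg.nullDeriv_pullback hu hL.lower hL.pos hy s), pd_const_mul, pd_comp_affineMap _ hd, hx0,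
      Fin.sum_univ_four, hL.lower 0 1 (by decide), h2, h3]
    · ring
    · exact hd.comp _ (contDiff_affineMap.differentiable (by norm_num)).differentiableAt
  rw [hpd, hg.nullDeriv_pullback hu hL.lower hL.pos hz, hx0, hg.einstein_pullback hu hL.lower hz,
    hg.einstein_pullback hu hL.lower hz, hx0] at key
  simp only [hg.pd_pullback hz, hx0] at key
  have hsum : ∑ α, ∑ β, L α 0 * (L β 0 + s * L β 1) * einstein g α β x
      = ∑ α, ∑ β, L α 0 * L β 0 * einstein g α β x
        + s * ∑ α, ∑ β, L α 0 * L β 1 * einstein g α β x := by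
    simp only [Finset.mul_sum, ← Finset.sum_add_distrib]
    exact Finset.sum_congr rfl fun α _ => Finset.sum_congr rfl fun β _ => by ring
  rw [← hsum] at key
  rw [drift]
  generalize driftJet _ s = a at key ⊢
  generalize ∑ α, ∑ β, L α 0 * (L β 0 + s * L β 1) * einstein g α β x = T at key ⊢
  have p0 := hL.pos 0
  have p1 := hL.pos 1
  have p2 := hL.pos 2
  have p3 := hL.pos 3
  have hc : 0 < (L 2 2 * L 3 3) ^ 2 / L 0 0 * L 1 1 := by positivity
  rw [← sub_nonneg] at key ⊢
  have h := div_nonneg key hc.le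
  refine h.trans_eq ?_
  field_simp

end

section

open Filter Topology Matrix

/-! ### Continuous adapted frames -/

section Cholesky

variable {X : Type*} [TopologicalSpace X] {S : Set X}

lemma exists_continuousOn_sqrt {F : X → ℝ} (hF : ContinuousOn F S) (hp : ∀ x ∈ S, 0 < F x) :
    ∃ l : X → ℝ, ContinuousOn l S ∧ (∀ x ∈ S, 0 < l x) ∧ ∀ x ∈ S, l x ^ 2 = F x :=
  ⟨fun x => √(F x), hF.sqrt, fun x hx => Real.sqrt_pos.2 (hp x hx),
    fun x hx => Real.sq_sqrt (hp x hx).le⟩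

lemma exists_continuousOn_div {F G : X → ℝ} (hF : ContinuousOn F S) (hG : ContinuousOn G S)
    (hp : ∀ x ∈ S, 0 < G x) : ∃ l : X → ℝ, ContinuousOn l S ∧ ∀ x ∈ S, l x * G x = F x :=
  ⟨fun x => F x / G x, hF.div hG fun x hx => (hp x hx).ne',
    fun x hx => div_mul_cancel₀ _ (hp x hx).ne'⟩

/-- A continuous Cholesky decomposition for forms of signature `(-,+,+,+)` that are positive on the
annihilator of a timelike vector. -/
lemma exists_continuousOn_cholesky {A : X → Matrix (Fin 4) (Fin 4) ℝ}
    (hA : ∀ i j, ContinuousOn (fun x => A x i j) S) (hsymm : ∀ x ∈ S, ∀ i j, A x i j = A x j i)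
    (h00 : ∀ x ∈ S, A x 0 0 < 0)
    (hpos : ∀ x ∈ S, ∀ p : Fin 4 → ℝ, p ≠ 0 → ∑ ν, A x 0 ν * p ν = 0 →
      0 < ∑ μ, ∑ ν, A x μ ν * p μ * p ν) :
    ∃ L : X → Matrix (Fin 4) (Fin 4) ℝ, (∀ i j, ContinuousOn (fun x => L x i j) S) ∧
      ∀ x ∈ S, (∀ i j, i < j → L x i j = 0) ∧ (∀ i, 0 < L x i i) ∧
        A x = L x * Matrix.diagonal sgn * (L x)ᵀ := by
  obtain ⟨l0, c0, p0, e0⟩ := exists_continuousOn_sqrt (hA 0 0).neg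
    (fun x hx => neg_pos.2 (h00 x hx))
  obtain ⟨m1, cm1, em1⟩ := exists_continuousOn_div (hA 1 0).neg c0 p0
  obtain ⟨m2, cm2, em2⟩ := exists_continuousOn_div (hA 2 0).neg c0 p0
  obtain ⟨m3, cm3, em3⟩ := exists_continuousOn_div (hA 3 0).neg c0 p0
  have a00 : ∀ x ∈ S, A x 0 0 = -l0 x ^ 2 := fun x hx => by have := e0 x hx; simp at this; linarith
  have a01 : ∀ x ∈ S, A x 0 1 = -(m1 x * l0 x) := fun x hx => by
    rw [hsymm x hx]; have := em1 x hx; simp at this; linarith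
  have a02 : ∀ x ∈ S, A x 0 2 = -(m2 x * l0 x) := fun x hx => by
    rw [hsymm x hx]; have := em2 x hx; simp at this; linarith
  have a03 : ∀ x ∈ S, A x 0 3 = -(m3 x * l0 x) := fun x hx => by
    rw [hsymm x hx]; have := em3 x hx; simp at this; linarith
  have q1 : ∀ x ∈ S, 0 < A x 1 1 + m1 x ^ 2 := by
    intro x hx
    have l0p := p0 x hx
    -- The test covector is annihilated by row 0 of `A x`, and the form evaluated on it is the next
    -- pivot, the Schur complement. The same choice is made for the later pivots.
    have h := hpos x hx ![-m1 x / l0 x, 1, 0, 0] (fun h => by simpa using congrFun h 1)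
    simp only [Fin.sum_univ_four, hsymm x hx 1 0, a00 x hx, a01 x hx] at h
    simp only [Matrix.cons_val] at h
    refine (h ?_).trans_eq ?_
    · field_simp; ring
    · field_simp; ring
  obtain ⟨l1, c1, p1, e1⟩ := exists_continuousOn_sqrt ((hA 1 1).add (cm1.pow 2)) q1
  obtain ⟨n2, cn2, en2⟩ := exists_continuousOn_div ((hA 2 1).add (cm2.mul cm1)) c1 p1
  obtain ⟨n3, cn3, en3⟩ := exists_continuousOn_div ((hA 3 1).add (cm3.mul cm1)) c1 p1
  have a11 : ∀ x ∈ S, A x 1 1 = l1 x ^ 2 - m1 x ^ 2 := fun x hx => by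
    have := e1 x hx; simp only [Pi.add_apply, Pi.pow_apply] at this; linarith
  have a12 : ∀ x ∈ S, A x 1 2 = n2 x * l1 x - m2 x * m1 x := fun x hx => by
    rw [hsymm x hx]; have := en2 x hx; simp at this; linarith
  have a13 : ∀ x ∈ S, A x 1 3 = n3 x * l1 x - m3 x * m1 x := fun x hx => by
    rw [hsymm x hx]; have := en3 x hx; simp at this; linarith
  have q2 : ∀ x ∈ S, 0 < A x 2 2 + m2 x ^ 2 - n2 x ^ 2 := by
    intro x hx
    have l0p := p0 x hx
    have l1p := p1 x hx
    have h := hpos x hx ![-(m2 x - m1 x * n2 x / l1 x) / l0 x, -n2 x / l1 x, 1, 0]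
      (fun h => by simpa using congrFun h 2)
    simp only [Fin.sum_univ_four, hsymm x hx 1 0, hsymm x hx 2 0, hsymm x hx 2 1, a00 x hx,
      a01 x hx, a02 x hx, a11 x hx, a12 x hx] at h
    simp only [Matrix.cons_val] at h
    refine (h ?_).trans_eq ?_
    · field_simp; ring
    · field_simp; ring
  obtain ⟨l2, c2, p2, e2⟩ := exists_continuousOn_sqrt
    (((hA 2 2).add (cm2.pow 2)).sub (cn2.pow 2)) q2
  obtain ⟨k3, ck3, ek3⟩ := exists_continuousOn_div
    (((hA 3 2).add (cm3.mul cm2)).sub (cn3.mul cn2)) c2 p2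
  have a22 : ∀ x ∈ S, A x 2 2 = l2 x ^ 2 - m2 x ^ 2 + n2 x ^ 2 := fun x hx => by
    have := e2 x hx; simp only [Pi.add_apply, Pi.sub_apply, Pi.pow_apply] at this; linarith
  have a23 : ∀ x ∈ S, A x 2 3 = k3 x * l2 x - m3 x * m2 x + n3 x * n2 x := fun x hx => by
    rw [hsymm x hx]; have := ek3 x hx; simp at this; linarith
  have q3 : ∀ x ∈ S, 0 < A x 3 3 + m3 x ^ 2 - n3 x ^ 2 - k3 x ^ 2 := by
    intro x hx
    have l0p := p0 x hx
    have l1p := p1 x hx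
    have l2p := p2 x hx
    -- Back substitution: `(u0, u1, u2, 1)` is chosen so that components 0, 1, 2 of its product with
    -- the transposed factor vanish, which leaves only the last pivot.
    obtain ⟨u2, hu2⟩ : ∃ u, l2 x * u + k3 x = 0 := ⟨-k3 x / l2 x, by field_simp; ring⟩
    obtain ⟨u1, hu1⟩ : ∃ u, l1 x * u + n2 x * u2 + n3 x = 0 :=
      ⟨-(n2 x * u2 + n3 x) / l1 x, by field_simp; ring⟩
    obtain ⟨u0, hu0⟩ : ∃ u, l0 x * u + m1 x * u1 + m2 x * u2 + m3 x = 0 :=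
      ⟨-(m1 x * u1 + m2 x * u2 + m3 x) / l0 x, by field_simp; ring⟩
    have h := hpos x hx ![u0, u1, u2, 1] (fun h => by simpa using congrFun h 3)
    simp only [Fin.sum_univ_four, hsymm x hx 1 0, hsymm x hx 2 0, hsymm x hx 2 1, hsymm x hx 3 0,
      hsymm x hx 3 1, hsymm x hx 3 2, a00 x hx, a01 x hx, a02 x hx, a03 x hx, a11 x hx, a12 x hx,
      a13 x hx, a22 x hx, a23 x hx] at h
    simp only [Matrix.cons_val] at h
    refine (h ?_).trans_eq ?_
    · linear_combination (-l0 x) * hu0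
    · linear_combination (-(l0 x * u0 + m1 x * u1 + m2 x * u2 + m3 x)) * hu0
        + (l1 x * u1 + n2 x * u2 + n3 x) * hu1 + (l2 x * u2 + k3 x) * hu2
  obtain ⟨l3, c3, p3, e3⟩ := exists_continuousOn_sqrt
    ((((hA 3 3).add (cm3.pow 2)).sub (cn3.pow 2)).sub (ck3.pow 2)) q3
  have a33 : ∀ x ∈ S, A x 3 3 = l3 x ^ 2 - m3 x ^ 2 + n3 x ^ 2 + k3 x ^ 2 := fun x hx => by
    have := e3 x hx; simp only [Pi.add_apply, Pi.sub_apply, Pi.pow_apply] at this; linarith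
  refine ⟨fun x => !![l0 x, 0, 0, 0; m1 x, l1 x, 0, 0; m2 x, n2 x, l2 x, 0;
    m3 x, n3 x, k3 x, l3 x], ?_, fun x hx => ⟨?_, ?_, ?_⟩⟩
  · intro i j
    fin_cases i <;> fin_cases j <;> first | assumption | exact continuousOn_const
  · intro i j hij
    fin_cases i <;> fin_cases j <;> first | rfl | exact absurd hij (by decide)
  · intro i
    fin_cases i
    exacts [p0 x hx, p1 x hx, p2 x hx, p3 x hx]
  · ext i j
    rw [Matrix.mul_apply]
    simp only [Matrix.mul_diagonal, Matrix.transpose_apply, Fin.sum_univ_four]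
    fin_cases i <;> fin_cases j <;>
      simp [sgn, hsymm x hx 1 0, hsymm x hx 2 0, hsymm x hx 2 1, hsymm x hx 3 0,
        hsymm x hx 3 1, hsymm x hx 3 2, a00 x hx, a01 x hx, a02 x hx, a03 x hx, a11 x hx,
        a12 x hx, a13 x hx, a22 x hx, a23 x hx, a33 x hx] <;> ring

end Cholesky

end

section

open Filter Topology Matrix

/-! ### The metric on the slab -/

variable {I : Set ℝ} {g : MetricField} {x : Point}

lemma isOpen_slab (hI : IsOpen I) : IsOpen (slab I) := hI.preimage (continuous_apply 0)

/-- No regularity of `F` is needed: where `F` is not differentiable, `fderiv` is zero by convention.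
-/
lemma pd_two_eq_zero {F : Point → ℝ} (hF : IsT2Invariant I F) (hx : x ∈ slab I) :
    pd 2 F x = 0 := by
  by_cases hd : DifferentiableAt ℝ F x
  · rw [pd, ← hd.lineDeriv_eq_fderiv, lineDeriv]
    have : (fun t : ℝ => F (x + t • unitVec 2)) = fun _ => F x := by
      ext t; simpa using hF x hx t 0
    rw [this]; simp
  · simp [pd, fderiv_zero_of_not_differentiableAt hd]

lemma pd_three_eq_zero {F : Point → ℝ} (hF : IsT2Invariant I F) (hx : x ∈ slab I) :
    pd 3 F x = 0 := by
  by_cases hd : DifferentiableAt ℝ F x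
  · rw [pd, ← hd.lineDeriv_eq_fderiv, lineDeriv]
    have : (fun t : ℝ => F (x + t • unitVec 3)) = fun _ => F x := by
      ext t; simpa using hF x hx 0 t
    rw [this]; simp
  · simp [pd, fderiv_zero_of_not_differentiableAt hd]

/-- Symmetry is implied by the signature condition, since `g x` is congruent to a diagonal matrix.
-/
lemma IsSpacetimeOnTorus.symm (h : IsSpacetimeOnTorus I g) (hx : x ∈ slab I) :
    (g x)ᵀ = g x := by
  obtain ⟨P, hP, hPg⟩ := h.lorentzian x hx
  have hPt : IsUnit Pᵀ.det := by rwa [Matrix.det_transpose]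
  have h1 : Pᵀ * (g x)ᵀ * P = Pᵀ * g x * P := by
    have := congrArg Matrix.transpose hPg
    rw [Matrix.diagonal_transpose, ← hPg] at this
    simpa only [Matrix.transpose_mul, Matrix.transpose_transpose, Matrix.mul_assoc] using this
  have h2 := congrArg (fun X => Pᵀ⁻¹ * X * P⁻¹) h1
  simpa only [Matrix.mul_assoc, Matrix.mul_nonsing_inv _ hP, Matrix.mul_one,
    ← Matrix.mul_assoc Pᵀ⁻¹, Matrix.nonsing_inv_mul _ hPt, Matrix.one_mul] using h2

lemma IsSpacetimeOnTorus.det_neg (h : IsSpacetimeOnTorus I g) (hx : x ∈ slab I) :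
    (g x).det < 0 := by
  obtain ⟨P, hP, hPg⟩ := h.lorentzian x hx
  have := congrArg Matrix.det hPg
  rw [Matrix.det_mul, Matrix.det_mul, Matrix.det_transpose, Matrix.det_diagonal] at this
  simp only [Fin.prod_univ_four, Matrix.cons_val] at this
  have hsq : 0 < P.det ^ 2 := by have := hP.ne_zero; positivity
  nlinarith

lemma isRegularOn_slab (h : IsSpacetimeOnTorus I g) (hinv : IsT2Invariant I g) :
    IsRegularOn g (slab I) where
  isOpen := isOpen_slab h.isOpen
  smooth _ hx μ ν := (h.smooth μ ν).contDiffAt ((isOpen_slab h.isOpen).mem_nhds hx)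
  det_ne_zero _ hx := (h.det_neg hx).ne
  symm _ hx μ ν := congrFun (congrFun (h.symm hx) ν) μ
  pd_two _ hx μ ν := pd_two_eq_zero
    (fun y hy a b => congrFun (congrFun (hinv y hy a b) μ) ν) hx
  pd_three _ hx μ ν := pd_three_eq_zero
    (fun y hy a b => congrFun (congrFun (hinv y hy a b) μ) ν) hx

lemma inner4_eq_dotProduct (v w : Fin 4 → ℝ) : inner4 g x v w = v ⬝ᵥ (g x *ᵥ w) := by
  simp only [inner4, dotProduct, Matrix.mulVec, Finset.mul_sum]
  exact Finset.sum_congr rfl fun μ _ => Finset.sum_congr rfl fun ν _ => by ring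

lemma inner4_inv_mulVec (hdet : IsUnit (g x).det) (p w : Fin 4 → ℝ) :
    inner4 g x w ((g x)⁻¹ *ᵥ p) = w ⬝ᵥ p := by
  rw [inner4_eq_dotProduct, Matrix.mulVec_mulVec, Matrix.mul_nonsing_inv _ hdet, Matrix.one_mulVec]

lemma inner4_add_smul (n u : Fin 4 → ℝ) (c : ℝ) (hs : (g x)ᵀ = g x) :
    inner4 g x (u + c • n) (u + c • n)
      = inner4 g x u u + 2 * c * inner4 g x u n + c ^ 2 * inner4 g x n n := by
  have hc : n ⬝ᵥ (g x *ᵥ u) = u ⬝ᵥ (g x *ᵥ n) := by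
    rw [Matrix.dotProduct_mulVec, ← Matrix.mulVec_transpose, hs, dotProduct_comm]
  simp only [inner4_eq_dotProduct, Matrix.mulVec_add, Matrix.mulVec_smul, dotProduct_add,
    add_dotProduct, smul_dotProduct, dotProduct_smul, smul_eq_mul, hc]
  ring

namespace IsSpacetimeOnTorus

lemma isUnit_det (h : IsSpacetimeOnTorus I g) (hx : x ∈ slab I) : IsUnit (g x).det :=
  (h.det_neg hx).ne.isUnit

lemma inner4_nonneg (h : IsSpacetimeOnTorus I g) (hx : x ∈ slab I) {v : Fin 4 → ℝ}
    (hv : v 0 = 0) : 0 ≤ inner4 g x v v := by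
  by_cases h0 : v = 0
  · simp [h0, inner4]
  · exact (h.spacelike x hx v hv h0).le

lemma exists_timelike (h : IsSpacetimeOnTorus I g) (hx : x ∈ slab I) :
    ∃ w, inner4 g x w w < 0 := by
  obtain ⟨P, hP, hPg⟩ := h.lorentzian x hx
  refine ⟨P *ᵥ Pi.single 0 1, ?_⟩
  have h1 : inner4 g x (P *ᵥ Pi.single 0 1) (P *ᵥ Pi.single 0 1)
      = (Pi.single 0 1 : Fin 4 → ℝ) ⬝ᵥ ((Pᵀ * g x * P) *ᵥ Pi.single 0 1) := by
    rw [inner4_eq_dotProduct, ← Matrix.mulVec_mulVec, ← Matrix.mulVec_mulVec,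
      Matrix.dotProduct_mulVec (Pi.single 0 1), ← Matrix.mulVec_transpose,
      Matrix.transpose_transpose]
  rw [h1, hPg]
  simp

/-- Raising the index of `p` gives a nonzero vector tangent to the slice, and the quadratic form is
its squared length. -/
lemma gInv_pos (h : IsSpacetimeOnTorus I g) (hx : x ∈ slab I) {p : Fin 4 → ℝ} (hp : p ≠ 0)
    (h0 : ∑ ν, gInv g x 0 ν * p ν = 0) : 0 < ∑ μ, ∑ ν, gInv g x μ ν * p μ * p ν := by
  have hdet := h.isUnit_det hx
  have hv : (g x)⁻¹ *ᵥ p ≠ 0 := by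
    intro hv
    apply hp
    rw [← Matrix.one_mulVec p, ← Matrix.mul_nonsing_inv _ hdet, ← Matrix.mulVec_mulVec, hv,
      Matrix.mulVec_zero]
  have := h.spacelike x hx _ (show ((g x)⁻¹ *ᵥ p) 0 = 0 from h0) hv
  rw [inner4_inv_mulVec hdet] at this
  refine this.trans_eq ?_
  simp only [dotProduct, Matrix.mulVec, Finset.sum_mul, gInv]
  exact Finset.sum_congr rfl fun μ _ => Finset.sum_congr rfl fun ν _ => by ring

/-- Let `n` be `dx⁰` with raised index, so `g(n, n) = g⁰⁰` and `n` is normal to the slice. If `g⁰⁰ =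
0`, then `n` would be a null vector tangent to a spacelike slice. If `g⁰⁰ > 0`, every vector would
be the sum of a tangent vector and a multiple of `n`, orthogonal and of nonnegative length, and none
would be timelike. -/
lemma gInv_zero_zero_neg (h : IsSpacetimeOnTorus I g) (hx : x ∈ slab I) : gInv g x 0 0 < 0 := by
  have hdet := h.isUnit_det hx
  by_contra hcon
  have hn : ((g x)⁻¹ *ᵥ Pi.single 0 1) 0 = gInv g x 0 0 := by simp [gInv]
  have hnn : ∀ w, inner4 g x w ((g x)⁻¹ *ᵥ Pi.single 0 1) = w 0 := fun w => by
    rw [inner4_inv_mulVec hdet]; simp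
  rcases (not_lt.1 hcon).eq_or_lt with h0 | h0
  · have := h.gInv_pos hx (p := Pi.single 0 1) (by simp) (by simp [Pi.single_apply, ← h0])
    simp [Pi.single_apply, ← h0] at this
  · obtain ⟨w, hw⟩ := h.exists_timelike hx
    set n := (g x)⁻¹ *ᵥ Pi.single 0 1 with hn_def
    set c := w 0 / gInv g x 0 0 with hc
    have hu0 : (w - c • n) 0 = 0 := by
      simp only [Pi.sub_apply, Pi.smul_apply, hn, smul_eq_mul, hc]; field_simp; ring
    have hexp := inner4_add_smul (g := g) (x := x) n (w - c • n) c (h.symm hx)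
    rw [hnn, hu0, hnn, hn, sub_add_cancel] at hexp
    have := h.inner4_nonneg hx hu0
    have h2 : 0 ≤ c ^ 2 * gInv g x 0 0 := by positivity
    linarith

/-- A continuous adapted orthonormal frame. -/
lemma exists_frame (h : IsSpacetimeOnTorus I g) (hinv : IsT2Invariant I g) :
    ∃ L : Point → Matrix (Fin 4) (Fin 4) ℝ,
      (∀ i j, ContinuousOn (fun x => L x i j) (slab I)) ∧
      ∀ x ∈ slab I, IsAdaptedFrame (g x) (L x) := by
  have hg := isRegularOn_slab h hinv
  obtain ⟨L, hLc, hL⟩ := exists_continuousOn_cholesky (S := slab I) (A := fun x => (g x)⁻¹)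
    (fun i j x hx => (hg.contDiffAt_gInv hx i j).continuousAt.continuousWithinAt)
    (fun x hx i j => hg.gInv_symm hx i j) (fun x hx => h.gInv_zero_zero_neg hx)
    (fun x hx p hp h0 => h.gInv_pos hx hp h0)
  refine ⟨L, hLc, fun x hx => ⟨(hL x hx).1, (hL x hx).2.1, ?_⟩⟩
  have h1 : L x * (Matrix.diagonal sgn * (L x)ᵀ * g x) = 1 := by
    rw [← Matrix.mul_assoc, ← Matrix.mul_assoc, ← (hL x hx).2.2,
      Matrix.nonsing_inv_mul _ (h.isUnit_det hx)]
  rw [mul_eq_one_comm] at h1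
  calc _ = Matrix.diagonal sgn * Matrix.diagonal sgn * ((L x)ᵀ * g x * L x) := by
        rw [diagonal_sgn_mul_self, Matrix.one_mul]
    _ = Matrix.diagonal sgn * (Matrix.diagonal sgn * (L x)ᵀ * g x * L x) := by
        simp only [Matrix.mul_assoc]
    _ = _ := by rw [h1, Matrix.mul_one]

end IsSpacetimeOnTorus

/-! ### Reduction to a fundamental domain -/

/-- The point in the fundamental domain with the given first two coordinates. -/
def basePoint (τ θ : ℝ) : Point := ![τ, θ, 0, 0]

lemma exists_basePoint {β : Type*} {F : Point → β} (hT : IsT2Invariant I F)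
    (hper : ∀ x ∈ slab I, F (x + unitVec 1) = F x) (hx : x ∈ slab I) :
    F x = F (basePoint (x 0) (Int.fract (x 1))) := by
  have h1 : F x = F (basePoint (x 0) (x 1)) := by
    rw [← hT x hx (-x 2) (-x 3)]
    congr 1
    ext i; fin_cases i <;> simp [unitVec, basePoint]
  have hb : ∀ θ, basePoint (x 0) θ ∈ slab I := fun θ => hx
  have hp : Function.Periodic (fun θ => F (basePoint (x 0) θ)) 1 := by
    intro θ
    change F _ = F _
    rw [← hper _ (hb θ)]
    congr 1
    ext i; fin_cases i <;> simp [unitVec, basePoint]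
  rw [h1]
  have := hp.sub_int_mul_eq (x := x 1) ⌊x 1⌋
  simp only [mul_one] at this
  rw [← this, Int.fract]

end

section

open Filter Topology Matrix MeasureTheory

/-! ### The mass shell in an adapted frame -/

/-- Component `P(E_k)` of a covector in the frame given by the columns of `L`. -/
def frameMom (L : Matrix (Fin 4) (Fin 4) ℝ) (P : Fin 4 → ℝ) (k : Fin 4) : ℝ := ∑ α, L α k * P α

/-- The squared length of the spatial part of the momentum in an adapted frame. -/
def frameSq (L : Matrix (Fin 4) (Fin 4) ℝ) (P : Fin 4 → ℝ) : ℝ :=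
  frameMom L P 1 ^ 2 + frameMom L P 2 ^ 2 + frameMom L P 3 ^ 2

lemma frameSq_nonneg (L : Matrix (Fin 4) (Fin 4) ℝ) (P : Fin 4 → ℝ) : 0 ≤ frameSq L P := by
  unfold frameSq; positivity

variable {I : Set ℝ} {g : MetricField} {f : Point → Mom → ℝ} {x : Point}
  {L : Matrix (Fin 4) (Fin 4) ℝ}

lemma momLower_zero (p : Mom) : momLower g x p 0 = energy g x p := rfl

lemma momLower_one (p : Mom) : momLower g x p 1 = p 0 := rfl

lemma momLower_two (p : Mom) : momLower g x p 2 = p 1 := rfl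

lemma momLower_three (p : Mom) : momLower g x p 3 = p 2 := rfl

namespace IsAdaptedFrame

/-- In the frame the mass shell reads `P(E₀)² = 1 + frameSq`. As `L 0 k = 0` for `k ≥ 1`, `frameSq`
involves only the spatial components, and the future directed root is the one with `P(E₀) < 0`. -/
lemma energy_eq (h : IsAdaptedFrame (g x) L) (p : Mom) :
    energy g x p = -(L 1 0 * p 0 + L 2 0 * p 1 + L 3 0 * p 2
      + √(1 + frameSq L (momLower g x p))) / L 0 0 := by
  have h0 := h.pos 0
  have hs : frameSq L (momLower g x p) = (L 1 1 * p 0 + L 2 1 * p 1 + L 3 1 * p 2) ^ 2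
      + (L 2 2 * p 1 + L 3 2 * p 2) ^ 2 + (L 3 3 * p 2) ^ 2 := by
    simp only [frameSq, frameMom, Fin.sum_univ_four, h.lower 0 1 (by decide),
      h.lower 0 2 (by decide), h.lower 0 3 (by decide), h.lower 1 2 (by decide),
      h.lower 1 3 (by decide), h.lower 2 3 (by decide), momLower_one, momLower_two, momLower_three]
    ring
  have hQ := frameSq_nonneg L (momLower g x p)
  set Q := frameSq L (momLower g x p)
  simp only [energy, Fin.sum_univ_three]
  simp only [Fin.succ_zero_eq_one, Fin.succ_one_eq_two, show Fin.succ (2 : Fin 3) = 3 from rfl,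
    gInv, h.inv_apply, Fin.sum_univ_four, h.lower 0 1 (by decide),
    h.lower 0 2 (by decide), h.lower 0 3 (by decide), h.lower 1 2 (by decide),
    h.lower 1 3 (by decide), h.lower 2 3 (by decide)]
  simp only [sgn, Matrix.cons_val]
  have hr : ∀ e : ℝ, e = L 0 0 ^ 2 * (1 + Q) → √e = L 0 0 * √(1 + Q) := by
    rintro e rfl
    rw [Real.sqrt_mul (sq_nonneg _), Real.sqrt_sq h0.le]
  rw [hr _ (by rw [hs]; ring)]
  field_simp
  ring

lemma frameMom_zero (h : IsAdaptedFrame (g x) L) (p : Mom) :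
    frameMom L (momLower g x p) 0 = -√(1 + frameSq L (momLower g x p)) := by
  have h0 := (h.pos 0).ne'
  simp only [frameMom, Fin.sum_univ_four, momLower_zero, momLower_one, momLower_two,
    momLower_three, h.energy_eq p]
  field_simp
  ring

lemma momUpper_zero (h : IsAdaptedFrame (g x) L) (p : Mom) :
    momUpper g x p 0 = L 0 0 * √(1 + frameSq L (momLower g x p)) := by
  have h1 : momUpper g x p 0 = -L 0 0 * frameMom L (momLower g x p) 0 := by
    simp only [momUpper, frameMom, gInv, h.inv_apply, Fin.sum_univ_four, h.lower 0 1 (by decide),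
      h.lower 0 2 (by decide), h.lower 0 3 (by decide)]
    simp [sgn]; ring
  rw [h1, h.frameMom_zero]; ring

lemma momUpper_zero_pos (h : IsAdaptedFrame (g x) L) (p : Mom) : 0 < momUpper g x p 0 := by
  rw [h.momUpper_zero]
  have := frameSq_nonneg L (momLower g x p)
  exact mul_pos (h.pos 0) (Real.sqrt_pos.2 (by linarith))

/-- The coefficients of a covector are recovered from its frame components. -/
lemma eq_sum_frameMom (h : IsAdaptedFrame (g x) L) (hdet : IsUnit (g x).det) (P : Fin 4 → ℝ)
    (α : Fin 4) :
    P α = ∑ k, (g x * L * Matrix.diagonal sgn) α k * frameMom L P k := by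
  have h1 : g x * L * Matrix.diagonal sgn * Lᵀ = 1 := by
    rw [Matrix.mul_assoc, Matrix.mul_assoc, ← Matrix.mul_assoc L, ← h.inv_eq,
      Matrix.mul_nonsing_inv _ hdet]
  have h2 : (g x * L * Matrix.diagonal sgn) *ᵥ (Lᵀ *ᵥ P) = P := by
    rw [Matrix.mulVec_mulVec, h1, Matrix.one_mulVec]
  exact (congrFun h2 α).symm

/-- The dominant energy condition for one particle, strict because of the mass: `|P(E₁)| < √(1 +
frameSq) = -P(E₀)`, so both factors are negative. -/
lemma timelike_mul_null_pos (h : IsAdaptedFrame (g x) L) (p : Mom) (s : ℝ) (hs : s ^ 2 = 1) :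
    0 < frameMom L (momLower g x p) 0
      * (frameMom L (momLower g x p) 0 + s * frameMom L (momLower g x p) 1) := by
  have hQ := frameSq_nonneg L (momLower g x p)
  have hE := Real.sq_sqrt (show 0 ≤ 1 + frameSq L (momLower g x p) by linarith)
  have hE0 := Real.sqrt_nonneg (1 + frameSq L (momLower g x p))
  have hq : (s * frameMom L (momLower g x p) 1) ^ 2 < √(1 + frameSq L (momLower g x p)) ^ 2 := by
    rw [hE, mul_pow, hs, frameSq]
    nlinarith [sq_nonneg (frameMom L (momLower g x p) 2), sq_nonneg (frameMom L (momLower g x p) 3)]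
  have hlt := abs_lt.1 (abs_lt_of_sq_lt_sq hq hE0)
  rw [h.frameMom_zero]
  exact mul_pos_of_neg_of_neg (by linarith [hlt.1, hlt.2]) (by linarith [hlt.1, hlt.2])

end IsAdaptedFrame

lemma continuous_energy : Continuous fun p : Mom => energy g x p := by
  unfold energy; fun_prop

lemma continuous_momLower (μ : Fin 4) : Continuous fun p : Mom => momLower g x p μ := by
  refine Fin.cases ?_ (fun i => ?_) μ
  · exact continuous_energy
  · exact continuous_apply i

lemma continuous_momUpper (μ : Fin 4) : Continuous fun p : Mom => momUpper g x p μ :=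
  continuous_finsetSum _ fun ν _ => continuous_const.mul (continuous_momLower ν)

/-- The energy density seen by the pair of the unit normal and a null vector of the frame. -/
def nullStress (g : MetricField) (f : Point → Mom → ℝ) (L : Matrix (Fin 4) (Fin 4) ℝ) (s : ℝ)
    (x : Point) : ℝ :=
  ∑ α, ∑ β, L α 0 * (L β 0 + s * L β 1) * stressEnergy g f α β x

lemma hasCompactSupport_of_bounded {F : Mom → ℝ} {C : ℝ} (hF : ∀ p, C < ‖p‖ → F p = 0) :
    HasCompactSupport F := by
  refine HasCompactSupport.intro (isCompact_closedBall (0 : Mom) C) fun p hp => hF p ?_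
  simpa using hp

/-- Bounded momentum support makes every component of the stress-energy an integral of a continuous
compactly supported function; this justifies exchanging sum and integral. -/
lemma nullStress_eq (h : IsAdaptedFrame (g x) L) (hdet : (g x).det < 0)
    (hf : Continuous (f x)) {C : ℝ} (hC : ∀ p, C < ‖p‖ → f x p = 0) (s : ℝ) :
    nullStress g f L s x = ∫ p, f x p * (frameMom L (momLower g x p) 0
      * (frameMom L (momLower g x p) 0 + s * frameMom L (momLower g x p) 1)
      / (√(-(g x).det) * momUpper g x p 0)) := by
  have hd : ∀ p, √(-(g x).det) * momUpper g x p 0 ≠ 0 := fun p =>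
    (mul_pos (Real.sqrt_pos.2 (by linarith)) (h.momUpper_zero_pos p)).ne'
  have hint : ∀ μ ν, Integrable fun p : Mom => f x p * momLower g x p μ * momLower g x p ν
      / (√(-(g x).det) * momUpper g x p 0) := by
    intro μ ν
    refine Continuous.integrable_of_hasCompactSupport ?_
      (hasCompactSupport_of_bounded (C := C) fun p hp => by simp [hC p hp])
    exact ((hf.mul (continuous_momLower μ)).mul (continuous_momLower ν)).div
      (continuous_const.mul (continuous_momUpper 0)) hd
  simp only [nullStress, stressEnergy, ← integral_const_mul]
  simp_rw [← integral_finsetSum (Finset.univ) fun ν _ => (hint _ ν).const_mul _]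
  rw [← integral_finsetSum _ fun μ _ => integrable_finsetSum _ fun ν _ => (hint μ ν).const_mul _]
  congr 1
  ext p
  have hfm : frameMom L (momLower g x p) 0 + s * frameMom L (momLower g x p) 1
      = ∑ β, (L β 0 + s * L β 1) * momLower g x p β := by
    simp only [frameMom, Finset.mul_sum, ← Finset.sum_add_distrib]
    exact Finset.sum_congr rfl fun β _ => by ring
  rw [hfm, frameMom, Finset.sum_mul_sum]
  simp only [Finset.sum_div, Finset.mul_sum]
  refine Finset.sum_congr rfl fun α _ => Finset.sum_congr rfl fun β _ => ?_
  have := hd p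
  field_simp

lemma nullStress_nonneg (h : IsAdaptedFrame (g x) L) (hdet : (g x).det < 0)
    (hf : Continuous (f x)) {C : ℝ} (hC : ∀ p, C < ‖p‖ → f x p = 0) (hnn : ∀ p, 0 ≤ f x p) (s : ℝ)
    (hs : s ^ 2 = 1) : 0 ≤ nullStress g f L s x := by
  rw [nullStress_eq h hdet hf hC]
  refine integral_nonneg fun p => mul_nonneg (hnn p) (div_nonneg ?_ ?_)
  · exact (h.timelike_mul_null_pos p s hs).le
  · exact mul_nonneg (Real.sqrt_nonneg _) (h.momUpper_zero_pos p).le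

lemma nullStress_pos (h : IsAdaptedFrame (g x) L) (hdet : (g x).det < 0)
    (hf : Continuous (f x)) {C : ℝ} (hC : ∀ p, C < ‖p‖ → f x p = 0) (hnn : ∀ p, 0 ≤ f x p) (s : ℝ)
    (hs : s ^ 2 = 1) {p₀ : Mom} (hp₀ : f x p₀ ≠ 0) : 0 < nullStress g f L s x := by
  rw [nullStress_eq h hdet hf hC]
  have hd : ∀ p, 0 < √(-(g x).det) * momUpper g x p 0 := fun p =>
    mul_pos (Real.sqrt_pos.2 (by linarith)) (h.momUpper_zero_pos p)
  have hw : ∀ p, 0 < frameMom L (momLower g x p) 0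
      * (frameMom L (momLower g x p) 0 + s * frameMom L (momLower g x p) 1)
      / (√(-(g x).det) * momUpper g x p 0) := fun p =>
    div_pos (h.timelike_mul_null_pos p s hs) (hd p)
  have hcm : ∀ k, Continuous fun p => frameMom L (momLower g x p) k := fun k =>
    continuous_finsetSum _ fun α _ => continuous_const.mul (continuous_momLower α)
  refine Continuous.integral_pos_of_hasCompactSupport_nonneg_nonzero (x := p₀) ?_ ?_ ?_ ?_
  · exact hf.mul (((hcm 0).mul ((hcm 0).add (continuous_const.mul (hcm 1)))).div
      (continuous_const.mul (continuous_momUpper 0)) fun p => (hd p).ne')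
  · exact hasCompactSupport_of_bounded (C := C) fun p hp => by simp [hC p hp]
  · exact fun p => mul_nonneg (hnn p) (hw p).le
  · exact mul_ne_zero hp₀ (hw p₀).ne'

end

section

open Filter Topology

/-! ### A differential inequality on the circle -/

/-- A periodic solution of `u' ≤ b u - N` with `N ≥ 0` that has a zero forces `N = 0`. -/
lemma source_nonpos_of_periodic_of_zero {u u' b N : ℝ → ℝ} (hu : ∀ θ, HasDerivAt u (u' θ) θ)
    (hper : Function.Periodic u 1) (hb : Continuous b) (hN : ∀ θ, 0 ≤ N θ)
    (hle : ∀ θ, u' θ ≤ b θ * u θ - N θ) {θ₀ : ℝ} (h0 : u θ₀ = 0) (θ : ℝ) : N θ ≤ 0 := by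
  set B : ℝ → ℝ := fun θ => ∫ t in θ₀..θ, b t with hB
  have hBd : ∀ θ, HasDerivAt B (b θ) θ := fun θ =>
    intervalIntegral.integral_hasDerivAt_right (hb.intervalIntegrable _ _)
      (hb.stronglyMeasurableAtFilter _ _) hb.continuousAt
  set z : ℝ → ℝ := fun θ => u θ * Real.exp (-B θ) with hz
  have hzd : ∀ θ, HasDerivAt z ((u' θ - b θ * u θ) * Real.exp (-B θ)) θ := fun θ => by
    refine ((hu θ).mul (hBd θ).fun_neg.exp).congr_deriv ?_
    ring
  have hzle : ∀ θ, deriv z θ ≤ -N θ * Real.exp (-B θ) := fun θ => by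
    rw [(hzd θ).deriv]
    exact mul_le_mul_of_nonneg_right (by linarith [hle θ]) (Real.exp_pos _).le
  have hanti : Antitone z := antitone_of_deriv_nonpos (fun θ => (hzd θ).differentiableAt) fun θ =>
    (hzle θ).trans (by nlinarith [hN θ, Real.exp_pos (-B θ)])
  -- The function `z` need not be periodic, because the integrating factor is not, but it inherits
  -- the zeros of `u` at `θ₀ ± n`. Being antitone, it vanishes between them, so its derivative at
  -- `θ` is zero.
  obtain ⟨n, hn⟩ := exists_nat_gt |θ - θ₀|
  rw [abs_lt] at hn
  have hp : z (θ₀ + n) = 0 := by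
    have := hper.nat_mul n θ₀
    rw [mul_one] at this
    simp [hz, this, h0]
  have hm : z (θ₀ - n) = 0 := by
    have := hper.sub_nat_mul_eq (x := θ₀) n
    rw [mul_one] at this
    simp [hz, this, h0]
  have hev : z =ᶠ[𝓝 θ] fun _ => 0 := by
    filter_upwards [Ioo_mem_nhds (show θ₀ - n < θ by linarith [hn.1])
      (show θ < θ₀ + n by linarith [hn.2])] with t ht
    exact le_antisymm (hm ▸ hanti ht.1.le) (hp ▸ hanti ht.2.le)
  have h1 : deriv z θ = 0 := by rw [hev.deriv_eq]; simp
  have h2 := hzle θ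
  rw [h1] at h2
  nlinarith [Real.exp_pos (-B θ)]

end

section

open Filter Topology

/-! ### A maximum principle for transport equations -/

/-- Vanishing of a nonnegative solution of a transport equation, periodic in the space variable,
propagates in momentum shells `{m ≤ h ≤ M}` that shrink at the maximal rate `C` of change of `h`
along the characteristics. -/
lemma transport_eq_zero {F : ℝ × ℝ × Mom → ℝ} {v : ℝ × ℝ × Mom → ℝ} {w : ℝ × ℝ × Mom → Mom}
    {h : Mom → ℝ} {σ τ₀ T C m M : ℝ} (hσ : σ ^ 2 = 1) (hC : 0 ≤ C)
    (hh : Differentiable ℝ h) (hhb : ∀ M, ∃ R, ∀ p, h p ≤ M → ‖p‖ ≤ R)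
    (hF : ∀ z : ℝ × ℝ × Mom, 0 ≤ σ * (z.1 - τ₀) → σ * (z.1 - τ₀) ≤ T → DifferentiableAt ℝ F z)
    (hnn : ∀ z : ℝ × ℝ × Mom, 0 ≤ σ * (z.1 - τ₀) → σ * (z.1 - τ₀) ≤ T → 0 ≤ F z)
    (hper : ∀ z : ℝ × ℝ × Mom, 0 ≤ σ * (z.1 - τ₀) → σ * (z.1 - τ₀) ≤ T →
      F z = F (z.1, Int.fract z.2.1, z.2.2))
    (heq : ∀ z : ℝ × ℝ × Mom, 0 ≤ σ * (z.1 - τ₀) → σ * (z.1 - τ₀) ≤ T → z.2.1 ∈ Set.Icc (0 : ℝ) 1 →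
      fderiv ℝ F z (1, v z, w z) = 0)
    (hbd : ∀ z : ℝ × ℝ × Mom, 0 ≤ σ * (z.1 - τ₀) → σ * (z.1 - τ₀) ≤ T → z.2.1 ∈ Set.Icc (0 : ℝ) 1 →
      |fderiv ℝ h z.2.2 (w z)| ≤ C)
    (h0 : ∀ θ p, m ≤ h p → h p ≤ M → F (τ₀, θ, p) = 0)
    {θ₁ : ℝ} {p₁ : Mom} (hT : 0 ≤ T) (hm : m + C * T < h p₁) (hM : h p₁ < M - C * T) :
    F (τ₀ + σ * T, θ₁, p₁) = 0 := by
  by_contra hne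
  have hσσ : σ * σ = 1 := by rw [← sq, hσ]
  set S : ℝ × ℝ × Mom → ℝ := fun z => σ * (z.1 - τ₀) with hS
  set φ : ℝ × ℝ × Mom → ℝ := fun z => h z.2.2 - m - C * S z with hφ
  set ψ : ℝ × ℝ × Mom → ℝ := fun z => M - h z.2.2 - C * S z with hψ
  have hSc : Continuous S := by fun_prop
  have hhc := hh.continuous
  have hφc : Continuous φ := by fun_prop
  have hψc : Continuous ψ := by fun_prop
  set z₁ : ℝ × ℝ × Mom := (τ₀ + σ * T, Int.fract θ₁, p₁) with hz₁
  have hS₁ : S z₁ = T := by simp only [hS, hz₁]; linear_combination T * hσσ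
  have hF₁ : 0 < F z₁ := by
    have h2 := hper (τ₀ + σ * T, θ₁, p₁) (hS₁.symm ▸ hT : 0 ≤ S z₁) (hS₁.le : S z₁ ≤ T)
    rw [h2] at hne
    exact lt_of_le_of_ne (hnn z₁ (hS₁.symm ▸ hT : 0 ≤ S z₁) hS₁.le) (Ne.symm hne)
  have hφ₁ : 0 < φ z₁ := by simp only [hφ, hS₁]; linarith
  have hψ₁ : 0 < ψ z₁ := by simp only [hψ, hS₁]; linarith
  have hV₁ : 0 < F z₁ * φ z₁ * ψ z₁ := by positivity
  obtain ⟨ε, hε, hεT⟩ : ∃ ε : ℝ, 0 < ε ∧ ε * T < F z₁ * φ z₁ * ψ z₁ := by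
    refine ⟨F z₁ * φ z₁ * ψ z₁ / (T + 1), by positivity, ?_⟩
    rw [div_mul_eq_mul_div, div_lt_iff₀ (by linarith)]
    nlinarith
  -- The choice of `ε` makes `Φ z₁` positive. At a maximum of `Φ` over the compact set `K` the
  -- product `F φ ψ` is then positive, so the maximum lies neither on a shell edge nor on the
  -- initial slice.
  set Φ : ℝ × ℝ × Mom → ℝ := fun z => F z * φ z * ψ z - ε * S z with hΦ
  set K : Set (ℝ × ℝ × Mom) :=
    {z | 0 ≤ S z ∧ S z ≤ T ∧ z.2.1 ∈ Set.Icc (0 : ℝ) 1 ∧ 0 ≤ φ z ∧ 0 ≤ ψ z} with hK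
  have hKclosed : IsClosed K := by
    refine (isClosed_le continuous_const hSc).inter ((isClosed_le hSc continuous_const).inter
      ((isClosed_Icc.preimage (by fun_prop : Continuous fun z : ℝ × ℝ × Mom => z.2.1)).inter
      ((isClosed_le continuous_const hφc).inter (isClosed_le continuous_const hψc))))
  obtain ⟨R, hR⟩ := hhb M
  have hKc : IsCompact K := by
    refine IsCompact.of_isClosed_subset ((isCompact_closedBall τ₀ T).prod
      ((isCompact_Icc (a := (0 : ℝ)) (b := 1)).prod (isCompact_closedBall (0 : Mom) R)))
      hKclosed ?_
    rintro z ⟨h1, h2, h3, -, h5⟩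
    refine ⟨?_, h3, ?_⟩
    · rw [Metric.mem_closedBall, Real.dist_eq]
      refine abs_le_of_sq_le_sq ?_ hT
      have : (z.1 - τ₀) ^ 2 = S z ^ 2 := by simp only [hS]; rw [mul_pow, hσ, one_mul]
      rw [this]; gcongr
    · rw [mem_closedBall_zero_iff]
      refine hR _ ?_
      have : 0 ≤ C * S z := mul_nonneg hC h1
      simp only [hψ] at h5; linarith
  have hz₁K : z₁ ∈ K := ⟨hS₁.symm ▸ hT, hS₁.le, ⟨Int.fract_nonneg _, (Int.fract_lt_one _).le⟩,
    hφ₁.le, hψ₁.le⟩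
  have hΦc : ContinuousOn Φ K := fun z hz =>
    ((((hF z hz.1 hz.2.1).continuousAt.mul hφc.continuousAt).mul hψc.continuousAt).sub
      (continuousAt_const.mul hSc.continuousAt)).continuousWithinAt
  obtain ⟨z, hzK, hmax⟩ := hKc.exists_isMaxOn ⟨z₁, hz₁K⟩ hΦc
  have hΦz : 0 < Φ z := by
    refine lt_of_lt_of_le ?_ (hmax hz₁K)
    simp only [hΦ, hS₁]; linarith
  obtain ⟨hz1, hz2, hz3, hz4, hz5⟩ := hzK
  have hV : 0 < F z * φ z * ψ z := by
    have : 0 ≤ ε * S z := by positivity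
    simp only [hΦ] at hΦz; linarith
  have hφz : 0 < φ z := lt_of_le_of_ne hz4 fun h => by simp [← h] at hV
  have hψz : 0 < ψ z := lt_of_le_of_ne hz5 fun h => by simp [← h] at hV
  have hFz : 0 < F z := lt_of_le_of_ne (hnn z hz1 hz2) fun h => by simp [← h] at hV
  have hSz : 0 < S z := by
    refine lt_of_le_of_ne hz1 fun hS0 => ?_
    have h1 : z.1 = τ₀ := by
      have : σ * S z = z.1 - τ₀ := by simp only [hS]; linear_combination (z.1 - τ₀) * hσσ
      rw [← hS0] at this; linarith
    have h2 := h0 z.2.1 z.2.2 (by simp only [hφ, ← hS0] at hz4; linarith)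
      (by simp only [hψ, ← hS0] at hz5; linarith)
    rw [← h1] at h2
    exact hFz.ne' h2
  -- A straight line through the maximum, tangent to the characteristic and run towards `τ₀`; first
  -- order agreement at `z` suffices, so no flow has to be constructed.
  set γ : ℝ → ℝ × ℝ × Mom := fun r => z + r • (-σ • ((1 : ℝ), v z, w z)) with hγ
  have hγ0 : γ 0 = z := by simp [hγ]
  have hγd : HasDerivAt γ (-σ • ((1 : ℝ), v z, w z)) 0 := by
    exact (((hasDerivAt_id (0 : ℝ)).smul_const (-σ • ((1 : ℝ), v z, w z))).const_add z).congr_deriv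
      (one_smul ℝ _)
  have hγS : ∀ r, S (γ r) = S z - r := fun r => by
    simp only [hS, hγ, Prod.fst_add, Prod.smul_fst, smul_eq_mul]; linear_combination -r * hσσ
  have hFd : HasDerivAt (fun r => F (γ r)) 0 0 := by
    have h1 : HasFDerivAt F (fderiv ℝ F z) (γ 0) := by
      rw [hγ0]; exact (hF z hz1 hz2).hasFDerivAt
    refine (h1.comp_hasDerivAt 0 hγd).congr_deriv ?_
    rw [map_smul, heq z hz1 hz2 hz3, smul_zero]
  set H := fderiv ℝ h z.2.2 (w z) with hH
  have hhd : HasDerivAt (fun r => h (γ r).2.2) (-σ * H) 0 := by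
    have h1 : HasFDerivAt h (fderiv ℝ h z.2.2) (γ 0).2.2 := by
      rw [hγ0]; exact (hh _).hasFDerivAt
    have h2 : HasDerivAt (fun r => (γ r).2.2) (-σ • w z) 0 := hγd.snd.snd
    refine (h1.comp_hasDerivAt 0 h2).congr_deriv ?_
    rw [map_smul, smul_eq_mul]
  have hSd : HasDerivAt (fun r => S (γ r)) (-1) 0 := by
    simp only [hγS]
    simpa using (hasDerivAt_id (0 : ℝ)).const_sub (S z)
  have hφd : HasDerivAt (fun r => φ (γ r)) (-σ * H - C * -1) 0 :=
    (hhd.sub_const m).sub (hSd.const_mul C)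
  have hψd : HasDerivAt (fun r => ψ (γ r)) (-(-σ * H) - C * -1) 0 :=
    (hhd.const_sub M).sub (hSd.const_mul C)
  have hΦd := ((hFd.fun_mul hφd).fun_mul hψd).fun_sub (hSd.const_mul ε)
  -- Along `γ` the derivative of `F` is zero, those of `φ` and `ψ` are `C ∓ σ H ≥ 0`, and the term
  -- `-ε S` contributes `ε > 0`.
  have hΦpos : 0 < (0 * φ (γ 0) + F (γ 0) * (-σ * H - C * -1)) * ψ (γ 0)
      + F (γ 0) * φ (γ 0) * (-(-σ * H) - C * -1) - ε * -1 := by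
    have hHC : |σ * H| ≤ C := by
      have hσa : |σ| = 1 := by rw [← sq_eq_sq₀ (abs_nonneg _) zero_le_one, sq_abs, hσ, one_pow]
      rw [abs_mul, hσa, one_mul]
      exact hbd z hz1 hz2 hz3
    rw [abs_le] at hHC
    rw [hγ0]
    have h1 : 0 ≤ F z * (C - σ * H) * ψ z := by
      have : 0 ≤ C - σ * H := by linarith
      positivity
    have h2 : 0 ≤ F z * φ z * (C + σ * H) := by
      have : 0 ≤ C + σ * H := by linarith
      positivity
    linarith
  have hev1 : ∀ᶠ r in 𝓝[>] (0 : ℝ), Φ z < Φ (γ r) := by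
    filter_upwards [hΦd.tendsto_slope_zero_right.eventually_const_lt hΦpos, self_mem_nhdsWithin]
      with r hr hr0
    rw [zero_add, smul_eq_mul] at hr
    have hr1 := pos_of_mul_pos_right hr (inv_pos.2 hr0).le
    rw [hγ0] at hr1
    exact sub_pos.1 hr1
  have hγc : ContinuousAt γ 0 := hγd.continuousAt
  have hev2 : ∀ᶠ r in 𝓝[>] (0 : ℝ), 0 < φ (γ r) ∧ 0 < ψ (γ r) ∧ 0 < S (γ r) := by
    apply nhdsWithin_le_nhds
    have h1 : ∀ G : ℝ × ℝ × Mom → ℝ, Continuous G → 0 < G z → ∀ᶠ r in 𝓝 (0 : ℝ), 0 < G (γ r) := by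
      intro G hG hGz
      refine (hG.continuousAt.comp hγc).eventually_const_lt ?_
      simpa [hγ0] using hGz
    exact (h1 φ hφc hφz).and ((h1 ψ hψc hψz).and (h1 S hSc hSz))
  obtain ⟨r, ⟨hr1, hr2, hr3, hr4⟩, hr5⟩ :=
    ((hev1.and hev2).and self_mem_nhdsWithin).exists
  have hrT : S (γ r) ≤ T := by
    rw [hγS]; have : 0 < r := hr5; linarith
  -- The curve may leave `0 ≤ θ ≤ 1`; reducing `θ` modulo one returns it to `K` without changing
  -- `Φ`, contradicting maximality.
  have hfr : Φ (γ r) = Φ ((γ r).1, Int.fract (γ r).2.1, (γ r).2.2) := by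
    simp only [hΦ, hφ, hψ, hS]
    rw [hper (γ r) hr4.le hrT]
  have := hmax (show ((γ r).1, Int.fract (γ r).2.1, (γ r).2.2) ∈ K from
    ⟨hr4.le, hrT, ⟨Int.fract_nonneg _, (Int.fract_lt_one _).le⟩, hr2.le, hr3.le⟩)
  simp only [Set.mem_ofPred_eq, ← hfr] at this
  linarith

end

section

open Filter Topology Matrix

/-! ### Propagation of the support of the distribution function -/

/-- A logarithmic weight on momentum space. -/
def momWeight (p : Mom) : ℝ := Real.log (1 + ∑ i, p i ^ 2)

lemma one_add_sum_sq_pos (p : Mom) : 0 < 1 + ∑ i, p i ^ 2 := by positivity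

lemma momWeight_nonneg (p : Mom) : 0 ≤ momWeight p :=
  Real.log_nonneg (by have : 0 ≤ ∑ i, p i ^ 2 := by positivity
                      linarith)

lemma hasFDerivAt_momWeight (p : Mom) : HasFDerivAt momWeight
    ((1 + ∑ i, p i ^ 2)⁻¹ • ∑ i, (2 * p i) • ContinuousLinearMap.proj (R := ℝ) (φ := fun _ => ℝ) i)
    p := by
  have h1 : HasFDerivAt (fun p : Mom => 1 + ∑ i, p i ^ 2)
      (∑ i, (2 * p i) • ContinuousLinearMap.proj (R := ℝ) (φ := fun _ => ℝ) i) p := by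
    refine (HasFDerivAt.fun_sum fun i _ => ?_).const_add 1
    have := (hasFDerivAt_apply (𝕜 := ℝ) (F' := fun _ : Fin 3 => ℝ) i p).pow 2
    simpa using this
  exact h1.log (one_add_sum_sq_pos p).ne'

lemma fderiv_momWeight (p w : Mom) :
    fderiv ℝ momWeight p w = (2 * ∑ i, p i * w i) / (1 + ∑ i, p i ^ 2) := by
  rw [(hasFDerivAt_momWeight p).fderiv]
  simp [Finset.mul_sum, div_eq_inv_mul, mul_assoc]

lemma norm_le_of_momWeight_le (M : ℝ) : ∃ R, ∀ p, momWeight p ≤ M → ‖p‖ ≤ R := by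
  refine ⟨√(Real.exp M), fun p hp => ?_⟩
  rw [momWeight, Real.log_le_iff_le_exp (one_add_sum_sq_pos p)] at hp
  refine (pi_norm_le_iff_of_nonneg (Real.sqrt_nonneg _)).2 fun i => Real.abs_le_sqrt ?_
  have := Finset.single_le_sum (f := fun i => p i ^ 2) (fun i _ => sq_nonneg _) (Finset.mem_univ i)
  linarith

lemma momWeight_le_of_norm_le {p : Mom} {C : ℝ} (hp : ‖p‖ ≤ C) :
    momWeight p ≤ Real.log (1 + 3 * C ^ 2) := by
  refine Real.log_le_log (one_add_sum_sq_pos p) ?_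
  have h : ∀ i, p i ^ 2 ≤ C ^ 2 := fun i => by
    have := (norm_le_pi_norm p i).trans hp
    rw [Real.norm_eq_abs] at this
    exact sq_le_sq.2 (this.trans (le_abs_self C))
  rw [Fin.sum_univ_three]
  linarith [h 0, h 1, h 2]

/-- The rate of change of the spatial momentum along the geodesic flow, with respect to the time
coordinate. -/
def force (g : MetricField) (x : Point) (p : Mom) : Mom := fun i =>
  -(1 / 2) * (∑ α, ∑ β, pd i.succ (fun y => gInv g y α β) x * momLower g x p α * momLower g x p β)
    / momUpper g x p 0

/-- A bound for the logarithmic rate of change of the momentum. -/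
def forceBound (g : MetricField) (L : Matrix (Fin 4) (Fin 4) ℝ) (x : Point) : ℝ :=
  (∑ i : Fin 3, ∑ α, ∑ β, |pd i.succ (fun y => gInv g y α β) x|)
    * (∑ α, ∑ k, |(g x * L * Matrix.diagonal sgn) α k|) ^ 2 / L 0 0
    * (3 + 3 * ∑ k, ∑ i, L i k ^ 2)

variable {I : Set ℝ} {g : MetricField} {f : Point → Mom → ℝ} {x : Point}
  {L : Matrix (Fin 4) (Fin 4) ℝ}

lemma IsAdaptedFrame.frameSq_le (h : IsAdaptedFrame (g x) L) (p : Mom) :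
    frameSq L (momLower g x p) ≤ (∑ k, ∑ i, L i k ^ 2) * ∑ i, p i ^ 2 := by
  have hk : ∀ k, L 0 k = 0 →
      frameMom L (momLower g x p) k ^ 2 ≤ (∑ i, L i k ^ 2) * ∑ i, p i ^ 2 := by
    intro k hk
    have hc := Finset.sum_mul_sq_le_sq_mul_sq Finset.univ (fun i : Fin 3 => L i.succ k) p
    have h1 : frameMom L (momLower g x p) k = ∑ i : Fin 3, L i.succ k * p i := by
      rw [frameMom, Fin.sum_univ_succ, hk, zero_mul, zero_add]
      rfl
    rw [h1, Fin.sum_univ_succ (fun i => L i k ^ 2), hk]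
    simpa using hc
  have h1 := hk 1 (h.lower 0 1 (by decide))
  have h2 := hk 2 (h.lower 0 2 (by decide))
  have h3 := hk 3 (h.lower 0 3 (by decide))
  have h0 : 0 ≤ (∑ i, L i 0 ^ 2) * ∑ i, p i ^ 2 := by positivity
  rw [frameSq, Fin.sum_univ_four (fun k => ∑ i, L i k ^ 2)]
  linarith

/-- The force is quadratic in the four-momentum, whose components are all of order `E = √(1 +
frameSq)`, divided by `p⁰ = L 0 0 * E`. It therefore grows at most linearly in `E`. -/
lemma abs_force_le (h : IsAdaptedFrame (g x) L) (hdet : IsUnit (g x).det) (p : Mom) (i : Fin 3) :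
    |force g x p i| ≤ (1 / 2) * (∑ α, ∑ β, |pd i.succ (fun y => gInv g y α β) x|)
      * (∑ α, ∑ k, |(g x * L * Matrix.diagonal sgn) α k|) ^ 2 / L 0 0
      * √(1 + frameSq L (momLower g x p)) := by
  have hQ := frameSq_nonneg L (momLower g x p)
  set E := √(1 + frameSq L (momLower g x p)) with hE
  have hEsq : E ^ 2 = 1 + frameSq L (momLower g x p) := Real.sq_sqrt (by linarith)
  have hEpos : 0 < E := Real.sqrt_pos.2 (by linarith)
  set c := ∑ α, ∑ k, |(g x * L * Matrix.diagonal sgn) α k| with hc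
  have hc0 : 0 ≤ c := by positivity
  have hq : ∀ k, |frameMom L (momLower g x p) k| ≤ E := by
    intro k
    refine abs_le_of_sq_le_sq ?_ hEpos.le
    rw [hEsq]
    unfold frameSq
    fin_cases k
    · change frameMom L (momLower g x p) 0 ^ 2 ≤ _
      rw [h.frameMom_zero, neg_sq, Real.sq_sqrt (by linarith), frameSq]
    all_goals
      dsimp
      nlinarith [sq_nonneg (frameMom L (momLower g x p) 1),
        sq_nonneg (frameMom L (momLower g x p) 2), sq_nonneg (frameMom L (momLower g x p) 3)]
  have hP : ∀ α, |momLower g x p α| ≤ c * E := by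
    intro α
    rw [h.eq_sum_frameMom hdet (momLower g x p) α]
    calc _ ≤ ∑ k, |(g x * L * Matrix.diagonal sgn) α k * frameMom L (momLower g x p) k| :=
          Finset.abs_sum_le_sum_abs _ _
      _ ≤ ∑ k, |(g x * L * Matrix.diagonal sgn) α k| * E := by
          refine Finset.sum_le_sum fun k _ => ?_
          rw [abs_mul]
          exact mul_le_mul_of_nonneg_left (hq k) (abs_nonneg _)
      _ = (∑ k, |(g x * L * Matrix.diagonal sgn) α k|) * E := by rw [Finset.sum_mul]
      _ ≤ c * E := by
          refine mul_le_mul_of_nonneg_right ?_ hEpos.le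
          exact Finset.single_le_sum
            (f := fun α => ∑ k, |(g x * L * Matrix.diagonal sgn) α k|)
            (fun α _ => by positivity) (Finset.mem_univ α)
  have hS : |∑ α, ∑ β, pd i.succ (fun y => gInv g y α β) x * momLower g x p α * momLower g x p β|
      ≤ (∑ α, ∑ β, |pd i.succ (fun y => gInv g y α β) x|) * (c * E) ^ 2 := by
    simp only [Finset.sum_mul]
    refine (Finset.abs_sum_le_sum_abs _ _).trans (Finset.sum_le_sum fun α _ => ?_)
    refine (Finset.abs_sum_le_sum_abs _ _).trans (Finset.sum_le_sum fun β _ => ?_)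
    rw [mul_assoc, abs_mul, abs_mul, sq]
    exact mul_le_mul_of_nonneg_left
      (mul_le_mul (hP α) (hP β) (abs_nonneg _) (by positivity)) (abs_nonneg _)
  have hL := h.pos 0
  rw [force, h.momUpper_zero, abs_div, abs_mul, abs_of_pos (mul_pos hL hEpos),
    div_le_iff₀ (mul_pos hL hEpos)]
  have h12 : |(-(1 / 2) : ℝ)| = 1 / 2 := by norm_num
  rw [h12]
  calc _ ≤ 1 / 2 * ((∑ α, ∑ β, |pd i.succ (fun y => gInv g y α β) x|) * (c * E) ^ 2) := by gcongr
    _ = _ := by field_simp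

/-- This is the reason for the logarithm: a force of linear growth changes `log (1 + |p|²)` at a
rate bounded uniformly in `p`. -/
lemma abs_fderiv_momWeight_force_le (h : IsAdaptedFrame (g x) L) (hdet : IsUnit (g x).det)
    (p : Mom) : |fderiv ℝ momWeight p (force g x p)| ≤ forceBound g L x := by
  have hQ := frameSq_nonneg L (momLower g x p)
  have hQ2 := h.frameSq_le p
  have hL := h.pos 0
  set E := √(1 + frameSq L (momLower g x p)) with hE
  have hEsq : E ^ 2 = 1 + frameSq L (momLower g x p) := Real.sq_sqrt (by linarith)
  set n := ∑ i, p i ^ 2 with hn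
  have hn0 : 0 ≤ n := by positivity
  set b := ∑ k, ∑ i, L i k ^ 2 with hb
  have hb0 : 0 ≤ b := by positivity
  set c := (∑ α, ∑ k, |(g x * L * Matrix.diagonal sgn) α k|) ^ 2 / L 0 0 with hc
  have hc0 : 0 ≤ c := by positivity
  set d : Fin 3 → ℝ := fun i => ∑ α, ∑ β, |pd i.succ (fun y => gInv g y α β) x| with hd
  have hd0 : ∀ i, 0 ≤ d i := fun i => by positivity
  -- From `2 |p i| E ≤ (p i)² + E²` and `E² ≤ 1 + b n`; the constant is generous.
  have hpE : ∀ i, |p i| * E ≤ (3 + 3 * b) * (1 + n) / 1 := by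
    intro i
    have h1 : p i ^ 2 ≤ n := Finset.single_le_sum (f := fun i => p i ^ 2)
      (fun i _ => sq_nonneg _) (Finset.mem_univ i)
    have h2 : 0 ≤ b * n := mul_nonneg hb0 hn0
    nlinarith [sq_nonneg (|p i| - E), sq_abs (p i)]
  rw [fderiv_momWeight, abs_div, abs_of_pos (one_add_sum_sq_pos p),
    div_le_iff₀ (one_add_sum_sq_pos p), abs_mul, abs_two]
  calc 2 * |∑ i, p i * force g x p i| ≤ 2 * ∑ i, |p i| * ((1 / 2) * d i * c * E) := by
        refine mul_le_mul_of_nonneg_left ?_ zero_le_two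
        refine (Finset.abs_sum_le_sum_abs _ _).trans (Finset.sum_le_sum fun i _ => ?_)
        rw [abs_mul]
        refine mul_le_mul_of_nonneg_left ((abs_force_le h hdet p i).trans_eq ?_) (abs_nonneg _)
        rw [hc, hd, hE]; ring
    _ = ∑ i, d i * c * (|p i| * E) := by
        rw [Finset.mul_sum]; exact Finset.sum_congr rfl fun i _ => by ring
    _ ≤ ∑ i, d i * c * ((3 + 3 * b) * (1 + n) / 1) :=
        Finset.sum_le_sum fun i _ => mul_le_mul_of_nonneg_left (hpE i) (mul_nonneg (hd0 i) hc0)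
    _ = forceBound g L x * (1 + n) := by
        rw [← Finset.sum_mul, ← Finset.sum_mul, forceBound, hc, hb]; ring

end

/-! ### The Vlasov equation as a transport equation over a section of the orbits. -/

section

open Filter Topology Matrix

variable {I : Set ℝ} {g : MetricField} {f : Point → Mom → ℝ} {x : Point}

lemma continuousOn_forceBound (hg : IsRegularOn g (slab I))
    {L : Point → Matrix (Fin 4) (Fin 4) ℝ} (hLc : ∀ i j, ContinuousOn (fun x => L x i j) (slab I))
    (hL : ∀ x ∈ slab I, IsAdaptedFrame (g x) (L x)) :
    ContinuousOn (fun x => forceBound g (L x) x) (slab I) := by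
  have hgc : ∀ i j, ContinuousOn (fun x => g x i j) (slab I) := fun i j x hx =>
    (hg.smooth x hx i j).continuousAt.continuousWithinAt
  have hdc : ∀ i α β, ContinuousOn (fun x => pd i (fun y => gInv g y α β) x) (slab I) :=
    fun i α β x hx =>
      (contDiffAt_pd i (hg.contDiffAt_gInv hx α β)).continuousAt.continuousWithinAt
  unfold forceBound
  refine ContinuousOn.mul (ContinuousOn.div (ContinuousOn.mul ?_ (ContinuousOn.pow ?_ 2))
    (hLc 0 0) fun x hx => ((hL x hx).pos 0).ne') (continuousOn_const.add
      (continuousOn_const.mul ?_))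
  · exact continuousOn_finsetSum _ fun i _ => continuousOn_finsetSum _ fun α _ =>
      continuousOn_finsetSum _ fun β _ => (hdc _ _ _).abs
  · refine continuousOn_finsetSum _ fun α _ => continuousOn_finsetSum _ fun k _ =>
      ContinuousOn.abs ?_
    simp only [Matrix.mul_apply]
    exact continuousOn_finsetSum _ fun k _ => (continuousOn_finsetSum _ fun j _ =>
      (hgc _ _).fun_mul (hLc _ _)).fun_mul continuousOn_const
  · exact continuousOn_finsetSum _ fun k _ => continuousOn_finsetSum _ fun i _ =>
      (hLc _ _).pow 2

/-- The parametrization of phase space over a section of the orbits. -/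
def phaseMap : ℝ × ℝ × Mom →L[ℝ] Point × Mom :=
  ((ContinuousLinearMap.fst ℝ ℝ (ℝ × Mom)).smulRight (unitVec 0)
    + ((ContinuousLinearMap.fst ℝ ℝ Mom).comp
      (ContinuousLinearMap.snd ℝ ℝ (ℝ × Mom))).smulRight (unitVec 1)).prod
  ((ContinuousLinearMap.snd ℝ ℝ Mom).comp (ContinuousLinearMap.snd ℝ ℝ (ℝ × Mom)))

lemma phaseMap_apply (z : ℝ × ℝ × Mom) : phaseMap z = (basePoint z.1 z.2.1, z.2.2) := by
  refine Prod.ext ?_ rfl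
  ext i
  fin_cases i <;> simp [phaseMap, basePoint, unitVec]

namespace IsT2SymmetricEinsteinVlasov

lemma differentiableAt_matter (h : IsT2SymmetricEinsteinVlasov I g f) (hx : x ∈ slab I) (p : Mom) :
    DifferentiableAt ℝ (fun z : Point × Mom => f z.1 z.2) (x, p) :=
  ((h.distribution.smooth).contDiffAt
    (((isOpen_slab h.spacetime.isOpen).prod isOpen_univ).mem_nhds ⟨hx, trivial⟩)).differentiableAt
    (by norm_num)

lemma continuous_matter (h : IsT2SymmetricEinsteinVlasov I g f) (hx : x ∈ slab I) :
    Continuous (f x) :=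
  continuous_iff_continuousAt.2 fun p =>
    (h.differentiableAt_matter hx p).continuousAt.comp (f := fun p => (x, p))
      (by fun_prop)

lemma fderiv_matter (h : IsT2SymmetricEinsteinVlasov I g f) (hx : x ∈ slab I) (u : Point)
    (p w : Mom) : fderiv ℝ (fun z : Point × Mom => f z.1 z.2) (x, p) (u, w)
      = ∑ μ, u μ * pd μ (fun y => f y p) x + ∑ i, w i * fderiv ℝ (f x) p (Pi.single i 1) := by
  have hd := h.differentiableAt_matter hx p
  have h1 : HasFDerivAt (fun y : Point => f y p) _ x :=
    hd.hasFDerivAt.comp (f := fun y : Point => (y, p)) x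
      ((hasFDerivAt_id x).prodMk (hasFDerivAt_const p x))
  have h2 : HasFDerivAt (f x) _ p :=
    hd.hasFDerivAt.comp (f := fun q : Mom => (x, q)) p
      ((hasFDerivAt_const x p).prodMk (hasFDerivAt_id p))
  have e1 : fderiv ℝ (fun y : Point => f y p) x u
      = fderiv ℝ (fun z : Point × Mom => f z.1 z.2) (x, p) (u, 0) := by
    rw [h1.fderiv]; simp
  have e2 : fderiv ℝ (f x) p w
      = fderiv ℝ (fun z : Point × Mom => f z.1 z.2) (x, p) (0, w) := by
    rw [h2.fderiv]; simp
  have e3 : fderiv ℝ (f x) p w = ∑ i, w i * fderiv ℝ (f x) p (Pi.single i 1) := by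
    conv_lhs => rw [pi_eq_sum_univ' w]
    simp
  rw [← e3, ← fderiv_apply_eq_sum_pd, e1, e2, ← map_add]
  simp

/-- The Vlasov equation divided by `p⁰`, so that coordinate time is the parameter; invariance
removes the derivatives in `x` and `y`. -/
lemma transport_eq (h : IsT2SymmetricEinsteinVlasov I g f) (hx : x ∈ slab I) (p : Mom)
    (hp : momUpper g x p 0 ≠ 0) :
    fderiv ℝ (fun z : Point × Mom => f z.1 z.2) (x, p)
      (unitVec 0 + (momUpper g x p 1 / momUpper g x p 0) • unitVec 1, force g x p) = 0 := by
  have hl := h.vlasov_eq x hx p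
  have h2 : pd 2 (fun y => f y p) x = 0 :=
    pd_two_eq_zero (fun y hy a b => congrFun (h.matter_invariant y hy a b) p) hx
  have h3 : pd 3 (fun y => f y p) x = 0 :=
    pd_three_eq_zero (fun y hy a b => congrFun (h.matter_invariant y hy a b) p) hx
  rw [h.fderiv_matter hx]
  simp only [liouville, Fin.sum_univ_four (fun μ => momUpper g x p μ * pd μ (fun y => f y p) x),
    h2, h3, mul_zero, add_zero] at hl
  have e1 : ∑ μ, (unitVec 0 + (momUpper g x p 1 / momUpper g x p 0) • unitVec 1) μ
      * pd μ (fun y => f y p) x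
      = (momUpper g x p 0 * pd 0 (fun y => f y p) x + momUpper g x p 1 * pd 1 (fun y => f y p) x)
        / momUpper g x p 0 := by
    rw [Fin.sum_univ_four, h2, h3]
    simp [unitVec]
    field_simp
  have e2 : ∑ i, force g x p i * fderiv ℝ (f x) p (Pi.single i 1)
      = -(1 / 2) * (∑ i : Fin 3, (∑ α, ∑ β, pd i.succ (fun y => gInv g y α β) x
        * momLower g x p α * momLower g x p β) * fderiv ℝ (f x) p (Pi.single i 1))
        / momUpper g x p 0 := by
    rw [Finset.mul_sum, Finset.sum_div]
    exact Finset.sum_congr rfl fun i _ => by rw [force]; ring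
  rw [e1, e2, ← add_div, div_eq_zero_iff]
  left
  linarith

/-- Vanishing of the distribution function in a momentum shell propagates from slice to slice. -/
lemma exists_propagation_rate (h : IsT2SymmetricEinsteinVlasov I g f) {τ₀ τ₁ : ℝ} (h₀ : τ₀ ∈ I)
    (h₁ : τ₁ ∈ I) : ∃ D : ℝ, ∀ m M : ℝ,
      (∀ θ p, m ≤ momWeight p → momWeight p ≤ M → f (basePoint τ₀ θ) p = 0) →
      ∀ θ p, m + D < momWeight p → momWeight p < M - D → f (basePoint τ₁ θ) p = 0 := by
  have hg := isRegularOn_slab h.spacetime h.metric_invariant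
  obtain ⟨L, hLc, hL⟩ := h.spacetime.exists_frame h.metric_invariant
  -- The sign `σ` treats propagation to the future and to the past together; both are used later.
  obtain ⟨σ, T, hσ, hT, hτ⟩ : ∃ σ T : ℝ, σ ^ 2 = 1 ∧ 0 ≤ T ∧ τ₁ = τ₀ + σ * T := by
    rcases le_total τ₀ τ₁ with hle | hle
    · exact ⟨1, τ₁ - τ₀, by norm_num, by linarith, by ring⟩
    · exact ⟨-1, τ₀ - τ₁, by norm_num, by linarith, by ring⟩
  have hI : ∀ τ, 0 ≤ σ * (τ - τ₀) → σ * (τ - τ₀) ≤ T → τ ∈ Set.uIcc τ₀ τ₁ := by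
    intro τ ha hb
    rw [Set.mem_uIcc, hτ]
    rcases mul_self_eq_one_iff.1 ((sq σ).symm.trans hσ) with rfl | rfl
    · left; constructor <;> linarith
    · right; constructor <;> linarith
  have hsub : Set.uIcc τ₀ τ₁ ⊆ I := h.spacetime.ordConnected.uIcc_subset h₀ h₁
  have hbase : ∀ τ θ, 0 ≤ σ * (τ - τ₀) → σ * (τ - τ₀) ≤ T → basePoint τ θ ∈ slab I :=
    fun τ θ ha hb => hsub (hI τ ha hb)
  -- Compactness of the time interval times one period of `θ` gives a rate independent of the
  -- momentum, so the resulting loss does not depend on `m` and `M`.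
  obtain ⟨C, hC⟩ : ∃ C, ∀ τ ∈ Set.uIcc τ₀ τ₁, ∀ θ ∈ Set.Icc (0 : ℝ) 1,
      forceBound g (L (basePoint τ θ)) (basePoint τ θ) ≤ C := by
    have hbc : Continuous fun q : ℝ × ℝ => basePoint q.1 q.2 := by
      unfold basePoint
      refine continuous_pi fun i => ?_
      fin_cases i <;> simp <;> fun_prop
    have hc : ContinuousOn (fun q : ℝ × ℝ => forceBound g (L (basePoint q.1 q.2))
        (basePoint q.1 q.2)) (Set.uIcc τ₀ τ₁ ×ˢ Set.Icc (0 : ℝ) 1) :=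
      (continuousOn_forceBound hg hLc hL).comp hbc.continuousOn fun q hq => hsub hq.1
    obtain ⟨C, hC⟩ := (isCompact_uIcc.prod isCompact_Icc).exists_bound_of_continuousOn hc
    exact ⟨C, fun τ hτ θ hθ => (le_abs_self _).trans (hC (τ, θ) ⟨hτ, hθ⟩)⟩
  refine ⟨max C 0 * T, fun m M h0 θ p hm hM => ?_⟩
  set F : ℝ × ℝ × Mom → ℝ := fun z => f (basePoint z.1 z.2.1) z.2.2 with hF
  have hFcomp : F = (fun z : Point × Mom => f z.1 z.2) ∘ phaseMap := by
    ext z; simp [hF, phaseMap_apply]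
  have hFd : ∀ z : ℝ × ℝ × Mom, 0 ≤ σ * (z.1 - τ₀) → σ * (z.1 - τ₀) ≤ T →
      HasFDerivAt F ((fderiv ℝ (fun z : Point × Mom => f z.1 z.2)
        (basePoint z.1 z.2.1, z.2.2)).comp phaseMap) z := by
    intro z ha hb
    rw [hFcomp]
    refine HasFDerivAt.comp z ?_ phaseMap.hasFDerivAt
    rw [phaseMap_apply]
    exact (h.differentiableAt_matter (hbase _ _ ha hb) _).hasFDerivAt
  rw [hτ]
  refine transport_eq_zero (F := F) (h := momWeight) (σ := σ) (τ₀ := τ₀) (T := T) (C := max C 0)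
    (v := fun z => momUpper g (basePoint z.1 z.2.1) z.2.2 1
      / momUpper g (basePoint z.1 z.2.1) z.2.2 0)
    (w := fun z => force g (basePoint z.1 z.2.1) z.2.2) hσ (le_max_right _ _)
    (fun p => (hasFDerivAt_momWeight p).differentiableAt) norm_le_of_momWeight_le
    (fun z ha hb => (hFd z ha hb).differentiableAt)
    (fun z ha hb => h.distribution.nonneg _ (hbase _ _ ha hb) _) ?_ ?_ ?_ h0 hT hm hM
  · intro z ha hb
    have := exists_basePoint h.matter_invariant
      (fun x hx => funext fun p => h.distribution.periodic x hx 0 p) (hbase z.1 z.2.1 ha hb)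
    exact congrFun this z.2.2
  · intro z ha hb hθ
    have hx := hbase z.1 z.2.1 ha hb
    rw [(hFd z ha hb).fderiv, ContinuousLinearMap.comp_apply]
    refine (congrArg _ ?_).trans (h.transport_eq hx z.2.2 ((hL _ hx).momUpper_zero_pos _).ne')
    simp [phaseMap]
  · intro z ha hb hθ
    have hx := hbase z.1 z.2.1 ha hb
    exact (abs_fderiv_momWeight_force_le (hL _ hx) (h.spacetime.isUnit_det hx) z.2.2).trans
      ((hC _ (hI _ ha hb) _ hθ).trans (le_max_left _ _))

end IsT2SymmetricEinsteinVlasov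

end

section

open Filter Topology Matrix

variable {I : Set ℝ} {g : MetricField} {f : Point → Mom → ℝ} {x : Point}

/-! ### Translation invariance of the null derivatives -/

lemma nullDeriv_add (hI : IsOpen I) {v : Point} (hv : ∀ y ∈ slab I, g (y + v) = g y)
    (hx : x ∈ slab I) (s : ℝ) : nullDeriv g s (x + v) = nullDeriv g s x := by
  have hW : ∀ k, pd k (areaSq g) (x + v) = pd k (areaSq g) x := by
    intro k
    have h1 : (fun y => areaSq g (y + v)) =ᶠ[𝓝 x] areaSq g := by
      filter_upwards [(isOpen_slab hI).mem_nhds hx] with y hy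
      simp only [areaSq, hv y hy]
    rw [pd, pd, ← h1.fderiv_eq, fderiv_comp_add_right]
  simp only [nullDeriv, gInv, hW, hv x hx]

lemma isT2Invariant_nullDeriv (hI : IsOpen I) (hg : IsT2Invariant I g) (s : ℝ) :
    IsT2Invariant I (nullDeriv g s) := by
  intro x hx a b
  rw [add_assoc]
  exact nullDeriv_add hI (fun y hy => by rw [← add_assoc, hg y hy a b]) hx s

lemma basePoint_eq (τ θ : ℝ) : basePoint τ θ = basePoint τ 0 + θ • unitVec 1 := by
  ext i; fin_cases i <;> simp [basePoint, unitVec]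

lemma hasDerivAt_basePoint (τ θ : ℝ) : HasDerivAt (basePoint τ) (unitVec 1) θ := by
  have h : HasDerivAt (fun θ : ℝ => basePoint τ 0 + θ • unitVec 1) ((1 : ℝ) • unitVec 1) θ :=
    ((hasDerivAt_id θ).smul_const (unitVec 1)).const_add _
  rw [one_smul] at h
  exact h.congr_of_eventuallyEq (Eventually.of_forall fun θ => basePoint_eq τ θ)

lemma continuousOn_driftJet {S : Set Point} {d : Point → Fin 4 → Fin 4 → Fin 4 → ℝ}
    (hd : ∀ l μ ν, ContinuousOn (fun x => d x l μ ν) S) (s : ℝ) :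
    ContinuousOn (fun x => driftJet (d x) s) S := by
  unfold driftJet
  fun_prop

lemma continuousOn_drift (hg : IsRegularOn g (slab I))
    {L : Point → Matrix (Fin 4) (Fin 4) ℝ} (hLc : ∀ i j, ContinuousOn (fun x => L x i j) (slab I))
    (hL : ∀ x ∈ slab I, IsAdaptedFrame (g x) (L x)) (s : ℝ) :
    ContinuousOn (fun x => drift g s (L x) x) (slab I) := by
  have hd : ∀ l μ ν, ContinuousOn (fun x => ∑ ρ, ∑ α, ∑ β, L x ρ l * L x α μ * L x β ν
      * pd ρ (fun y => g y α β) x) (slab I) := fun l μ ν =>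
    continuousOn_finsetSum _ fun ρ _ => continuousOn_finsetSum _ fun α _ =>
      continuousOn_finsetSum _ fun β _ => (((hLc _ _).fun_mul (hLc _ _)).fun_mul
        (hLc _ _)).fun_mul fun x hx =>
          (hg.contDiffAt_pd_metric hx ρ α β).continuousAt.continuousWithinAt
  exact (continuousOn_driftJet hd s).div (hLc 1 1) fun x hx => ((hL x hx).pos 1).ne'

lemma areaSq_pos {L : Matrix (Fin 4) (Fin 4) ℝ} (hL : IsAdaptedFrame (g x) L) :
    0 < areaSq g x := by
  have h := areaSq_pullback (g := g) (x₀ := x) (z := 0) hL.lower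
  rw [affineMap_zero] at h
  have h1 : areaSq (pullback g x L) 0 = 1 := by
    rw [areaSq, pullback, affineMap_zero, hL.orthonormal]; simp [sgn]
  rw [h1] at h
  have h2 := hL.pos 2
  have h3 := hL.pos 3
  by_contra hcon
  have : (L 2 2 * L 3 3) ^ 2 * areaSq g x ≤ 0 :=
    mul_nonpos_of_nonneg_of_nonpos (by positivity) (not_lt.1 hcon)
  linarith

lemma pd_orbitArea (hg : IsRegularOn g (slab I)) (hx : x ∈ slab I) (hpos : 0 < areaSq g x)
    (k : Fin 4 → ℝ) :
    fderiv ℝ (orbitArea g) x k = fderiv ℝ (areaSq g) x k / (2 * orbitArea g x) := by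
  have hd := (hg.contDiffAt_areaSq hx).differentiableAt (by norm_num)
  have h : HasFDerivAt (orbitArea g) ((1 / (2 * √(areaSq g x))) • fderiv ℝ (areaSq g) x) x :=
    hd.hasFDerivAt.sqrt hpos.ne'
  rw [h.fderiv, show orbitArea g x = √(areaSq g x) from rfl]
  simp only [_root_.smul_apply, smul_eq_mul]
  ring

/-! ### Absence of zeros of the null derivatives, and its consequences. -/

namespace IsT2SymmetricEinsteinVlasov

variable {t₀ : ℝ}

lemma exists_support_bound (h : IsT2SymmetricEinsteinVlasov I g f) (ht₀ : t₀ ∈ I)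
    (hsupp : HasBoundedSupportAt f t₀) {τ : ℝ} (hτ : τ ∈ I) :
    ∃ R, ∀ θ p, R < ‖p‖ → f (basePoint τ θ) p = 0 := by
  obtain ⟨C, hC⟩ := hsupp
  obtain ⟨D, hD⟩ := h.exists_propagation_rate ht₀ hτ
  -- The summand `1` makes every momentum of weight at least `m` have norm strictly greater than
  -- `C`. The upper edge of the shell is then chosen just above the given `p`, since `f` vanishes
  -- initially at all larger weights.
  set m := Real.log (1 + 3 * C ^ 2) + 1 with hm
  obtain ⟨R, hR⟩ := norm_le_of_momWeight_le (m + D)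
  refine ⟨R, fun θ p hp => hD m (momWeight p + D + 1) (fun θ q hq _ => ?_) θ p ?_ (by linarith)⟩
  · refine hC _ rfl q ?_
    by_contra hcon
    linarith [momWeight_le_of_norm_le (not_lt.1 hcon)]
  · by_contra hcon
    exact absurd (hR p (not_lt.1 hcon)) (not_le.2 hp)

lemma particleNumber_eq_zero (h : IsT2SymmetricEinsteinVlasov I g f) (ht₀ : t₀ ∈ I) {τ : ℝ}
    (hτ : τ ∈ I) (hf : ∀ θ p, f (basePoint τ θ) p = 0) : particleNumber f t₀ = 0 := by
  obtain ⟨D, hD⟩ := h.exists_propagation_rate hτ ht₀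
  have h0 : ∀ θ p, f (basePoint t₀ θ) p = 0 := fun θ p =>
    -- The shell is wide enough for `p` to remain inside after a loss of `D` at each edge; its lower
    -- edge then sits at `-1`, below every weight.
    hD (-D - 1) (momWeight p + D + 1) (fun θ q _ _ => hf θ q) θ p
      (by linarith [momWeight_nonneg p]) (by linarith)
  have h1 : ∀ z p, f (Matrix.vecCons t₀ z) p = 0 := fun z p => by
    have hz : (Matrix.vecCons t₀ z : Point) ∈ slab I := ht₀
    rw [exists_basePoint h.matter_invariant
      (fun x hx => funext fun p => h.distribution.periodic x hx 0 p) hz]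
    exact h0 _ p
  simp [particleNumber, h1]

/-- The null derivatives of the orbit area have no zeros. -/
lemma nullDeriv_ne_zero (h : IsT2SymmetricEinsteinVlasov I g f) (ht₀ : t₀ ∈ I)
    (hsupp : HasBoundedSupportAt f t₀) (hnum : particleNumber f t₀ ≠ 0) (hx : x ∈ slab I)
    {s : ℝ} (hs : s ^ 2 = 1) : nullDeriv g s x ≠ 0 := by
  intro hzero
  have hI := h.spacetime.isOpen
  have hg := isRegularOn_slab h.spacetime h.metric_invariant
  obtain ⟨L, hLc, hL⟩ := h.spacetime.exists_frame h.metric_invariant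
  have hinv := isT2Invariant_nullDeriv hI h.metric_invariant s
  have hper : ∀ x ∈ slab I, nullDeriv g s (x + unitVec 1) = nullDeriv g s x := fun x hx =>
    nullDeriv_add hI (fun y hy => h.spacetime.periodic y hy 0) hx s
  set τ := x 0 with hτ
  have hτI : τ ∈ I := hx
  have hb : ∀ θ, basePoint τ θ ∈ slab I := fun θ => hτI
  have hss : s * s = 1 := by rw [← sq, hs]
  have hbc : Continuous (basePoint τ) :=
    continuous_iff_continuousAt.2 fun θ => (hasDerivAt_basePoint τ θ).continuousAt
  have hdrift : Continuous fun θ => drift g s (L (basePoint τ θ)) (basePoint τ θ) :=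
    (continuousOn_drift hg hLc hL s).comp_continuous hbc hb
  obtain ⟨R, hR⟩ := h.exists_support_bound ht₀ hsupp hτI
  have hnn : ∀ θ, 0 ≤ nullStress g f (L (basePoint τ θ)) s (basePoint τ θ) := fun θ =>
    nullStress_nonneg (hL _ (hb θ)) (h.spacetime.det_neg (hb θ)) (h.continuous_matter (hb θ))
      (hR θ) (h.distribution.nonneg _ (hb θ)) s hs
  set κ : ℝ → ℝ := fun θ => 2 * L (basePoint τ θ) 0 0
    / ((L (basePoint τ θ) 2 2 * L (basePoint τ θ) 3 3) ^ 2 * L (basePoint τ θ) 1 1) with hκ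
  have hκpos : ∀ θ, 0 < κ θ := fun θ => by
    have h0 := (hL _ (hb θ)).pos 0
    have h1 := (hL _ (hb θ)).pos 1
    have h2 := (hL _ (hb θ)).pos 2
    have h3 := (hL _ (hb θ)).pos 3
    simp only [hκ]
    positivity
  have hderiv : ∀ θ, HasDerivAt (fun θ => s * nullDeriv g s (basePoint τ θ))
      (s * pd 1 (nullDeriv g s) (basePoint τ θ)) θ := fun θ => by
    have hd : DifferentiableAt ℝ (nullDeriv g s) (basePoint τ θ) := by
      refine (hg.contDiffAt_nullDeriv (hb θ) ?_ s).differentiableAt (by norm_num)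
      rw [(hL _ (hb θ)).discriminant]
      exact pow_ne_zero _ (mul_pos ((hL _ (hb θ)).pos 0) ((hL _ (hb θ)).pos 1)).ne'
    exact (hd.hasFDerivAt.comp_hasDerivAt θ (hasDerivAt_basePoint τ θ)).const_mul s
  -- The unknown is `s * nullDeriv`, so that both signs of `s` give an inequality `u' ≤ b u - N` in
  -- the direction of increasing `θ`; the Einstein equations turn the source into `nullStress`.
  have hev : ∀ θ, s * pd 1 (nullDeriv g s) (basePoint τ θ)
      ≤ s * drift g s (L (basePoint τ θ)) (basePoint τ θ) * (s * nullDeriv g s (basePoint τ θ))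
        - κ θ * nullStress g f (L (basePoint τ θ)) s (basePoint τ θ) := fun θ => by
    have := hg.nullDeriv_evolution (hb θ) (hL _ (hb θ)) s hs (pd_two_eq_zero hinv (hb θ))
      (pd_three_eq_zero hinv (hb θ))
    simp only [h.einstein_eq _ (hb θ)] at this
    refine this.trans_eq ?_
    simp only [hκ, nullStress]
    linear_combination (-drift g s (L (basePoint τ θ)) (basePoint τ θ)
      * nullDeriv g s (basePoint τ θ)) * hss
  have hperiod : Function.Periodic (fun θ => s * nullDeriv g s (basePoint τ θ)) 1 := fun θ => by
    have : basePoint τ (θ + 1) = basePoint τ θ + unitVec 1 := by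
      rw [basePoint_eq, basePoint_eq τ θ, add_smul, one_smul, add_assoc]
    simp only [this, hper _ (hb θ)]
  have hzero' : s * nullDeriv g s (basePoint τ (Int.fract (x 1))) = 0 := by
    rw [← exists_basePoint hinv hper hx, hzero, mul_zero]
  -- One zero kills the source on the whole circle. As `nullStress` is positive wherever some `f x
  -- p` is nonzero, the slice is empty of particles.
  have hN := source_nonpos_of_periodic_of_zero hderiv hperiod (continuous_const.mul hdrift)
    (fun θ => mul_nonneg (hκpos θ).le (hnn θ)) hev hzero'
  refine hnum (h.particleNumber_eq_zero ht₀ hτI fun θ p => ?_)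
  by_contra hp
  exact absurd (hN θ) (not_le.2 (mul_pos (hκpos θ) (nullStress_pos (hL _ (hb θ))
    (h.spacetime.det_neg (hb θ)) (h.continuous_matter (hb θ)) (hR θ)
    (h.distribution.nonneg _ (hb θ)) s hs hp)))

lemma gradient_ne_zero (h : IsT2SymmetricEinsteinVlasov I g f) (ht₀ : t₀ ∈ I)
    (hsupp : HasBoundedSupportAt f t₀) (hnum : particleNumber f t₀ ≠ 0) (hx : x ∈ slab I) :
    gradient g (orbitArea g) x ≠ 0 := by
  intro hgrad
  have hg := isRegularOn_slab h.spacetime h.metric_invariant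
  obtain ⟨L, -, hL⟩ := h.spacetime.exists_frame h.metric_invariant
  have hpos := areaSq_pos (hL x hx)
  have h1 : (g x)⁻¹ *ᵥ (fun ν => pd ν (orbitArea g) x) = 0 := hgrad
  have h2 : (fun ν => pd ν (orbitArea g) x) = 0 := by
    rw [← Matrix.one_mulVec fun ν => pd ν (orbitArea g) x,
      ← Matrix.mul_nonsing_inv _ (h.spacetime.isUnit_det hx), ← Matrix.mulVec_mulVec, h1,
      Matrix.mulVec_zero]
  have h3 : ∀ ν, pd ν (areaSq g) x = 0 := fun ν => by
    have := congrFun h2 ν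
    simp only [Pi.zero_apply] at this
    rw [pd, pd_orbitArea hg hx hpos, div_eq_zero_iff] at this
    refine this.resolve_right ?_
    have : 0 < orbitArea g x := Real.sqrt_pos.2 hpos
    positivity
  refine h.nullDeriv_ne_zero ht₀ hsupp hnum hx (s := 1) (by norm_num) ?_
  simp [nullDeriv, h3]

/-- In the adapted frame, orthogonality to the orbit removes the `E₂` and `E₃` components of `k`,
and nullity gives `κ 1 = ± κ 0` with `κ 0 ≠ 0`. So `k` is a multiple of `E₀ + s E₁` with `s = κ 1 /
κ 0`, and a zero of the derivative along `k` is a zero of `nullDeriv g s`. -/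
lemma fderiv_orbitArea_ne_zero (h : IsT2SymmetricEinsteinVlasov I g f) (ht₀ : t₀ ∈ I)
    (hsupp : HasBoundedSupportAt f t₀) (hnum : particleNumber f t₀ ≠ 0) (hx : x ∈ slab I)
    {k : Fin 4 → ℝ} (hk : IsOrbitNormalNull g x k) : fderiv ℝ (orbitArea g) x k ≠ 0 := by
  intro hzero
  have hg := isRegularOn_slab h.spacetime h.metric_invariant
  obtain ⟨L', -, hL'⟩ := h.spacetime.exists_frame h.metric_invariant
  have hL := hL' x hx
  set L := L' x
  have hpos := areaSq_pos hL
  rw [pd_orbitArea hg hx hpos, div_eq_zero_iff] at hzero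
  have hW := hzero.resolve_right
    (mul_pos two_pos (Real.sqrt_pos.2 hpos : 0 < orbitArea g x)).ne'
  obtain ⟨hk0, hkk, hk2, hk3⟩ := hk
  obtain ⟨κ, rfl⟩ : ∃ κ, k = L *ᵥ κ := ⟨L⁻¹ *ᵥ k, by
    rw [Matrix.mulVec_mulVec, Matrix.mul_nonsing_inv _ hL.isUnit_det, Matrix.one_mulVec]⟩
  have hin : ∀ w, inner4 g x (L *ᵥ κ) (L *ᵥ w) = ∑ i, κ i * sgn i * w i := by
    intro w
    have h1 : (L *ᵥ κ) ⬝ᵥ (g x *ᵥ (L *ᵥ w)) = κ ⬝ᵥ ((Lᵀ * g x * L) *ᵥ w) := by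
      rw [← Matrix.mulVec_mulVec, ← Matrix.mulVec_mulVec, Matrix.dotProduct_mulVec κ,
        ← Matrix.mulVec_transpose, Matrix.transpose_transpose]
    rw [inner4_eq_dotProduct, h1, hL.orthonormal]
    simp only [dotProduct, Matrix.mulVec_diagonal, mul_assoc]
  have hlin : ∀ (a b : ℝ), inner4 g x (L *ᵥ κ) (a • unitVec 2 + b • unitVec 3) = 0 := by
    intro a b
    rw [inner4_eq_dotProduct, Matrix.mulVec_add, Matrix.mulVec_smul, Matrix.mulVec_smul,
      dotProduct_add, dotProduct_smul, dotProduct_smul, ← inner4_eq_dotProduct,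
      ← inner4_eq_dotProduct, hk2, hk3]
    simp
  have e2 : L *ᵥ Pi.single 2 1 = L 2 2 • unitVec 2 + L 3 2 • unitVec 3 := by
    ext i
    fin_cases i <;> simp [unitVec, hL.lower 0 2 (by decide), hL.lower 1 2 (by decide)]
  have e3 : L *ᵥ Pi.single 3 1 = (0 : ℝ) • unitVec 2 + L 3 3 • unitVec 3 := by
    ext i
    fin_cases i <;> simp [unitVec, hL.lower 0 3 (by decide), hL.lower 1 3 (by decide),
      hL.lower 2 3 (by decide)]
  have κ2 : κ 2 = 0 := by
    have := hin (Pi.single 2 1)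
    rw [e2, hlin] at this
    simpa [Pi.single_apply, sgn] using this.symm
  have κ3 : κ 3 = 0 := by
    have := hin (Pi.single 3 1)
    rw [e3, hlin] at this
    simpa [Pi.single_apply, sgn] using this.symm
  have hκ : κ 1 ^ 2 = κ 0 ^ 2 := by
    rw [hin, Fin.sum_univ_four, κ2, κ3] at hkk
    simp only [sgn, Matrix.cons_val] at hkk
    linarith
  have κ0 : κ 0 ≠ 0 := by
    intro h0
    rw [h0, zero_pow two_ne_zero, pow_eq_zero_iff two_ne_zero] at hκ
    apply hk0
    have : κ = 0 := by
      ext i; fin_cases i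
      exacts [h0, hκ, κ2, κ3]
    rw [this, Matrix.mulVec_zero]
  have hs : (κ 1 / κ 0) ^ 2 = 1 := by
    rw [div_pow, hκ, div_self (pow_ne_zero _ κ0)]
  refine h.nullDeriv_ne_zero ht₀ hsupp hnum hx hs ?_
  have h00 : gInv g x 0 0 = -L 0 0 ^ 2 := by
    rw [gInv, hL.inv_apply, Fin.sum_univ_four, hL.lower 0 1 (by decide), hL.lower 0 2 (by decide),
      hL.lower 0 3 (by decide)]
    simp [sgn]; ring
  have h01 : gInv g x 0 1 = -(L 0 0 * L 1 0) := by
    rw [gInv, hL.inv_apply, Fin.sum_univ_four, hL.lower 0 1 (by decide), hL.lower 0 2 (by decide),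
      hL.lower 0 3 (by decide)]
    simp [sgn]
  have hD : √(gInv g x 0 1 ^ 2 - gInv g x 0 0 * gInv g x 1 1) = L 0 0 * L 1 1 := by
    rw [hL.discriminant, Real.sqrt_sq (mul_pos (hL.pos 0) (hL.pos 1)).le]
  rw [fderiv_apply_eq_sum_pd, Fin.sum_univ_four, hg.pd_areaSq_two hx, hg.pd_areaSq_three hx] at hW
  have k0 : (L *ᵥ κ) 0 = L 0 0 * κ 0 := by
    rw [Matrix.mulVec, dotProduct, Fin.sum_univ_four, hL.lower 0 1 (by decide), κ2, κ3]; ring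
  have k1 : (L *ᵥ κ) 1 = L 1 0 * κ 0 + L 1 1 * κ 1 := by
    rw [Matrix.mulVec, dotProduct, Fin.sum_univ_four, κ2, κ3]; ring
  rw [k0, k1] at hW
  rw [nullDeriv, hD, h00, h01]
  field_simp
  linear_combination L 0 0 * hW

end IsT2SymmetricEinsteinVlasov

end

end EinsteinVlasov

end

theorem mainTheorem4 (I : Set ℝ) (g : EinsteinVlasov.MetricField)
    (f : EinsteinVlasov.Point → EinsteinVlasov.Mom → ℝ)
    (hsol : EinsteinVlasov.IsT2SymmetricEinsteinVlasov I g f)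
    (t₀ : ℝ) (ht₀ : t₀ ∈ I)
    (hsupp : EinsteinVlasov.HasBoundedSupportAt f t₀)
    (hnum : EinsteinVlasov.particleNumber f t₀ ≠ 0) :
    (∀ x ∈ EinsteinVlasov.slab I,
      EinsteinVlasov.gradient g (EinsteinVlasov.orbitArea g) x ≠ 0) ∧
    (∀ x ∈ EinsteinVlasov.slab I, ∀ k : Fin 4 → ℝ,
      EinsteinVlasov.IsOrbitNormalNull g x k →
        fderiv ℝ (EinsteinVlasov.orbitArea g) x k ≠ 0) ∧
    ¬ ∃ c : ℝ, ∀ x ∈ EinsteinVlasov.slab I, EinsteinVlasov.orbitArea g x = c := by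
  refine ⟨fun x hx => hsol.gradient_ne_zero ht₀ hsupp hnum hx,
    fun x hx k hk => hsol.fderiv_orbitArea_ne_zero ht₀ hsupp hnum hx hk, ?_⟩
  rintro ⟨c, hc⟩
  have hx : EinsteinVlasov.basePoint t₀ 0 ∈ EinsteinVlasov.slab I := ht₀
  refine hsol.gradient_ne_zero ht₀ hsupp hnum hx ?_
  have hev : EinsteinVlasov.orbitArea g =ᶠ[nhds (EinsteinVlasov.basePoint t₀ 0)] fun _ => c :=
    Filter.eventually_of_mem
      ((EinsteinVlasov.isOpen_slab hsol.spacetime.isOpen).mem_nhds hx) hc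
  ext μ
  simp [EinsteinVlasov.gradient, EinsteinVlasov.pd_congr _ hev, EinsteinVlasov.pd_const]
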